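/- **Model.** Let $(\Omega,\mathcal F,\mathrm P)$ be a probability space with a filtration $(\mathcal F_t)_{t\ge 0}$, and consider $M\ge 2$ investors and $N\ge 1$ assets. For $t\ge1$ let $X_t=(X_t^1,\dots,X_t^N)\in\mathbb R_+^N$ be $\mathcal F_t$-measurable payoffs and $\rho_t\ge 0$ an $\mathcal F_{t-1}$-measurable gross return on a bank account, with $\rho_t+\sum_nX_t^n>0$ a.s. Write $|x|=\sum_n|x^n|$. Let $\Delta=\{\lambda\in\mathbb R_+^{MN}:\sum_n\lambda^{m,n}\le 1\text{ for each }m\}$. A strategy $\Lambda$ is a sequence of $\mathcal F_{t-1}\otimes\mathcal B(\mathbb R_+^M\times\Delta^{t-1})$-measurable functions $\Lambda_t(\omega,y_0,\lambda_1,\dots,\lambda_{t-1})$, $t\ge1$, with values in $\{v\in\mathbb R_+^N: |v|\le1\}$. Given a vector of initial capital $Y_0=(Y_0^1,\dots,Y_0^M)$ with all $Y_0^m>0$ (non-random) and strategies $\Lambda^1,\dots,\Lambda^M$, the realized proportions are $\lambda_t^m=\Lambda^m_t(\omega,Y_0,\lambda_1,\dots,\lambda_{t-1})$ and the wealth of investor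 $m$ satisfies $$Y_t^m=\rho_t\Bigl(1-\sum_n\lambda_t^{m,n}\Bigr)Y_{t-1}^m+\sum_n\frac{\lambda_t^{m,n}Y_{t-1}^m}{\sum_k\lambda_t^{k,n}Y_{t-1}^k}X_t^n,\qquad t\ge1\quad(0/0=0).$$ Let $r_t^m=Y_t^m/\sum_kY_t^k$ ($0/0=0$). A strategy of investor $m$ is called relative growth optimal if $\ln r_t^m$ is a submartingale for every vector of positive initial capital and all strategies of the other investors. **The strategy $\hat\Lambda$.** Let $K_t(\omega,dx)$ be a regular conditional distribution of $X_t$ with respect to $\mathcal F_{t-1}$. If $\int \frac{c\rho_t}{|x|}K_t(dx)>1$ (with $0/0=0$ and $a/0=+\infty$ for $a>0$), let $\zeta_t(c)$ be the unique $z\in(0,c]$ with $\int\frac{c\rho_t}{z\rho_t+|x|}K_t(dx)=1$; otherwise let $\zeta_t(c)=0$. Then $$\hat\Lambda_t^n(\omega,y_0,\lambda_1,\dots,\lambda_{t-1})=\int\frac{x^n}{\zeta_t(\omega,C_{t-1})\,\rho_t(\omega)+|x|}K_t(\omega,dx)\qquad(0/0=0),$$ where $C_{t-1}$ is the total wealth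 $\sum_mY_{t-1}^m$ computed by the wealth equation from the history $(y_0,\lambda_1,\dots,\lambda_{t-1})$. **Theorem.** Suppose investor 1 uses $\hat\Lambda$ (or any other relative growth optimal strategy) and the other investors use arbitrary strategies. Then for any vector of positive initial capital $Y_0$ the following holds, with $\ln 0=-\infty$. 1) For every $m$, $\displaystyle\limsup_{t\to\infty}\tfrac1t\ln Y_t^1\ \ge\ \limsup_{t\to\infty}\tfrac1t\ln Y_t^m$ a.s. 2) If $M=2$ and $\mathrm E|X_t|<\infty$ for all $t\ge1$, then for all $s,t\ge0$ $$\mathrm E\Bigl(\ln\frac{Y_{s+t}^1}{Y_s^1}\Bigm|\mathcal F_s\Bigr)\ \ge\ \mathrm E\Bigl(\ln\frac{Y_{s+t}^2}{Y_s^2}\Bigm|\mathcal F_s\Bigr)\quad\text{a.s.},$$ where $\ln\frac00=-\infty$ and $\mathrm E(\xi\mid\mathcal F_s)=\mathrm E(\xi^+\mid\mathcal F_s)-\mathrm E(\xi^-\mid\mathcal F_s)\in[-\infty,\infty]$, read as $-\infty$ at points where both terms are infinite. If moreover $\mathrm E\ln^+\rho_t<\infty$ for all $t\ge1$, then $\mathrm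 E(\ln^+(Y^m_{s+t}/Y^m_s)\mid\mathcal F_s)<\infty$ a.s. for $m=1,2$ and all $s,t\ge0$, so that both sides are well defined. -/

import Mathlib

open MeasureTheory ProbabilityTheory Filter
open scoped NNReal ENNReal

/-- Vectors of investment proportions of one investor: `v n ≥ 0` and `∑ n, v n ≤ 1`.  The
remaining proportion `1 - ∑ n, v n` is kept in the bank account. -/
abbrev Proportions (N : ℕ) : Type := {v : Fin N → ℝ≥0 // ∑ n, v n ≤ 1}

/-- The set `Δ` of joint investment proportions of the `M` investors. -/
abbrev JointProportions (M N : ℕ) : Type := Fin M → Proportions N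

/-- The exogenous data of the market.  `X t ω n` is the payoff of asset `n` at time `t` and
`ρ t ω` is the gross return on the bank account from time `t - 1` to time `t`, both for `t ≥ 1`
(the values at `t = 0` are never used).  Payoffs are adapted, `ρ` is predictable. -/
structure Market {Ω : Type*} [mΩ : MeasurableSpace Ω] (P : Measure Ω) (F : Filtration ℕ mΩ)
    (N : ℕ) where
  X : ℕ → Ω → Fin N → ℝ≥0
  ρ : ℕ → Ω → ℝ≥0
  adapted_X : ∀ t, Measurable[F (t + 1)] (X (t + 1))
  predictable_ρ : ∀ t, Measurable[F t] (ρ (t + 1))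
  pos : ∀ t, ∀ᵐ ω ∂P, 0 < ρ (t + 1) ω + ∑ n, X (t + 1) ω n

/-- A rule of behaviour of one investor: `Λ t ω y₀ (λ₁, …, λ_t)` is the vector of investment
proportions `λ_{t+1}` chosen at time `t`, given the initial capitals `y₀` and the past joint
proportions.  The `s`-th entry of the history (`s : Fin t`) is `λ_{s+1}`. -/
abbrev Rule (Ω : Type*) (M N : ℕ) : Type _ :=
  (t : ℕ) → Ω → (Fin M → ℝ≥0) → (Fin t → JointProportions M N) → Proportions N

/-- A strategy is a rule such that the choice made at time `t` is jointly measurable with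
respect to `F_t ⊗ Borel`. -/
def IsStrategy {Ω : Type*} [mΩ : MeasurableSpace Ω] (F : Filtration ℕ mΩ) {M N : ℕ}
    (Λ : Rule Ω M N) : Prop :=
  ∀ t, Measurable[(F t).prod
      (inferInstance : MeasurableSpace ((Fin M → ℝ≥0) × (Fin t → JointProportions M N)))]
    (fun p : Ω × ((Fin M → ℝ≥0) × (Fin t → JointProportions M N)) => Λ t p.1 p.2.1 p.2.2)

/-- One step of the wealth equation: from the wealth vector `y`, with joint proportions `l`,
gross bank return `ρ` and payoffs `x`.  Division is that of `ℝ≥0`, so `0 / 0 = 0`; the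
subtraction does not truncate because `∑ n, l m n ≤ 1`. -/
noncomputable def wealthStep {M N : ℕ} (ρ : ℝ≥0) (x : Fin N → ℝ≥0) (l : JointProportions M N)
    (y : Fin M → ℝ≥0) (m : Fin M) : ℝ≥0 :=
  ρ * (1 - ∑ n, (l m).1 n) * y m
    + ∑ n, (l m).1 n * y m / (∑ k, (l k).1 n * y k) * x n

namespace Market

variable {Ω : Type*} [mΩ : MeasurableSpace Ω] {P : Measure Ω} {F : Filtration ℕ mΩ} {M N : ℕ}

/-- The wealth vector at time `t` as a function of the history `(y₀, λ₁, …, λ_t)`. -/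
noncomputable def wealthOfHistory (S : Market P F N) (ω : Ω) (y₀ : Fin M → ℝ≥0) :
    (t : ℕ) → (Fin t → JointProportions M N) → Fin M → ℝ≥0
  | 0, _ => y₀
  | t + 1, h => wealthStep (S.ρ (t + 1) ω) (S.X (t + 1) ω) (h (Fin.last t))
      (wealthOfHistory S ω y₀ t (fun s => h s.castSucc))

/-- `K t ω` (for `t ≥ 1`) is a regular conditional distribution of the payoff vector `X_t` with
respect to `F_{t-1}`. -/
structure IsRegularConditionalLaw (S : Market P F N)
    (K : ℕ → Ω → ProbabilityMeasure (Fin N → ℝ≥0)) : Prop where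
  measurable : ∀ t, ∀ A : Set (Fin N → ℝ≥0), MeasurableSet A →
    Measurable[F t] (fun ω => (K (t + 1) ω : Measure (Fin N → ℝ≥0)) A)
  condProb : ∀ t, ∀ A : Set (Fin N → ℝ≥0), MeasurableSet A →
    (fun ω => (K (t + 1) ω : Measure (Fin N → ℝ≥0)).real A)
      =ᵐ[P] P[(S.X (t + 1) ⁻¹' A).indicator (fun _ => (1 : ℝ)) | F t]

end Market

/-- The condition `∫ c ρ / |x| K(dx) > 1`.  In `ℝ≥0∞` one has `0 / 0 = 0` and `a / 0 = ∞` for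
`a > 0`. -/
def InGamma {N : ℕ} (ρ : ℝ≥0) (κ : ProbabilityMeasure (Fin N → ℝ≥0)) (c : ℝ≥0) : Prop :=
  1 < ∫⁻ x, ((c * ρ : ℝ≥0) : ℝ≥0∞) / ((∑ n, x n : ℝ≥0) : ℝ≥0∞) ∂(κ : Measure (Fin N → ℝ≥0))

/-- `z ∈ (0, c]` solves `∫ c ρ / (z ρ + |x|) K(dx) = 1`. -/
def SolvesZeta {N : ℕ} (ρ : ℝ≥0) (κ : ProbabilityMeasure (Fin N → ℝ≥0)) (c z : ℝ≥0) : Prop :=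
  0 < z ∧ z ≤ c ∧
    ∫⁻ x, ((c * ρ : ℝ≥0) : ℝ≥0∞) / ((z * ρ + ∑ n, x n : ℝ≥0) : ℝ≥0∞)
      ∂(κ : Measure (Fin N → ℝ≥0)) = 1

open Classical in
/-- The function `ζ`: the (unique) solution `z ∈ (0, c]` of `∫ c ρ / (z ρ + |x|) K(dx) = 1` if
`∫ c ρ / |x| K(dx) > 1`, and zero otherwise. -/
noncomputable def zeta {N : ℕ} (ρ : ℝ≥0) (κ : ProbabilityMeasure (Fin N → ℝ≥0)) (c : ℝ≥0) :
    ℝ≥0 :=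
  if h : InGamma ρ κ c ∧ ∃ z, SolvesZeta ρ κ c z then h.2.choose else 0

/-- The proportion `∫ xⁿ / (z ρ + |x|) K(dx)`, where `0 / 0 = 0` and `a = z ρ`. -/
noncomputable def hatProportion {N : ℕ} (a : ℝ≥0) (κ : ProbabilityMeasure (Fin N → ℝ≥0))
    (n : Fin N) : ℝ≥0 :=
  (∫⁻ x, (x n : ℝ≥0∞) / ((a + ∑ k, x k : ℝ≥0) : ℝ≥0∞) ∂(κ : Measure (Fin N → ℝ≥0))).toNNReal

theorem sum_hatProportion_le_one {N : ℕ} (a : ℝ≥0) (κ : ProbabilityMeasure (Fin N → ℝ≥0)) :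
    ∑ n, hatProportion a κ n ≤ 1 := by
  have hmeas : ∀ n : Fin N, Measurable (fun x : Fin N → ℝ≥0 =>
      (x n : ℝ≥0∞) / ((a + ∑ k, x k : ℝ≥0) : ℝ≥0∞)) := by
    intro n
    fun_prop
  have hsum : ∑ n, ∫⁻ x, (x n : ℝ≥0∞) / ((a + ∑ k, x k : ℝ≥0) : ℝ≥0∞)
      ∂(κ : Measure (Fin N → ℝ≥0)) ≤ 1 := by
    rw [← lintegral_finsetSum _ (fun n _ => hmeas n)]
    calc ∫⁻ x, ∑ n, (x n : ℝ≥0∞) / ((a + ∑ k, x k : ℝ≥0) : ℝ≥0∞)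
          ∂(κ : Measure (Fin N → ℝ≥0))
        ≤ ∫⁻ _, 1 ∂(κ : Measure (Fin N → ℝ≥0)) := by
          refine lintegral_mono fun x => ?_
          simp only [div_eq_mul_inv]
          rw [← Finset.sum_mul, ← div_eq_mul_inv]
          refine ENNReal.div_le_of_le_mul ?_
          rw [one_mul]
          push_cast
          exact le_add_self
      _ = 1 := by simp
  have hfin : ∀ n ∈ Finset.univ, ∫⁻ x, (x n : ℝ≥0∞) / ((a + ∑ k, x k : ℝ≥0) : ℝ≥0∞)
      ∂(κ : Measure (Fin N → ℝ≥0)) ≠ ∞ := fun n hn =>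
    ne_top_of_le_ne_top ENNReal.one_ne_top
      ((Finset.single_le_sum (fun i _ => zero_le (a := _)) hn).trans hsum)
  unfold hatProportion
  rw [← ENNReal.toNNReal_sum hfin]
  exact ENNReal.toNNReal_mono ENNReal.one_ne_top hsum

namespace Market

variable {Ω : Type*} [mΩ : MeasurableSpace Ω] {P : Measure Ω} {F : Filtration ℕ mΩ} {M N : ℕ}

/-- The strategy `Λ̂`: with `C` the total wealth at time `t` computed from the history, the
proportion `λ_{t+1}` invested in asset `n` is `∫ xⁿ / (ζ_{t+1}(C) ρ_{t+1} + |x|) K_{t+1}(dx)`. -/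
noncomputable def hatRule (S : Market P F N)
    (K : ℕ → Ω → ProbabilityMeasure (Fin N → ℝ≥0)) : Rule Ω M N :=
  fun t ω y₀ h =>
    let C : ℝ≥0 := ∑ m, S.wealthOfHistory ω y₀ t h m
    let a : ℝ≥0 := zeta (S.ρ (t + 1) ω) (K (t + 1) ω) C * S.ρ (t + 1) ω
    ⟨hatProportion a (K (t + 1) ω), sum_hatProportion_le_one a (K (t + 1) ω)⟩

end Market

/-- The realized joint proportions `(λ₁(ω), …, λ_t(ω))` when the investors use the profile `L`
and have initial capitals `y₀`. -/
def realization {Ω : Type*} {M N : ℕ} (L : Fin M → Rule Ω M N) (y₀ : Fin M → ℝ≥0) (ω : Ω) :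
    (t : ℕ) → Fin t → JointProportions M N
  | 0 => Fin.elim0
  | t + 1 => Fin.snoc (α := fun _ => JointProportions M N) (realization L y₀ ω t)
      (fun m => L m t ω y₀ (realization L y₀ ω t))

namespace Market

variable {Ω : Type*} [mΩ : MeasurableSpace Ω] {P : Measure Ω} {F : Filtration ℕ mΩ} {M N : ℕ}

/-- The wealth `Y_t^m(ω)` of investor `m` at time `t`. -/
noncomputable def wealth (S : Market P F N) (L : Fin M → Rule Ω M N) (y₀ : Fin M → ℝ≥0)
    (t : ℕ) (m : Fin M) (ω : Ω) : ℝ≥0 :=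
  S.wealthOfHistory ω y₀ t (realization L y₀ ω t) m

/-- The relative wealth `r_t^m = Y_t^m / ∑ k, Y_t^k`, equal to zero if the total wealth is. -/
noncomputable def relWealth (S : Market P F N) (L : Fin M → Rule Ω M N) (y₀ : Fin M → ℝ≥0)
    (t : ℕ) (m : Fin M) (ω : Ω) : ℝ≥0 :=
  S.wealth L y₀ t m ω / ∑ k, S.wealth L y₀ t k ω

/-- A strategy `Λ` of investor `i` is relative growth optimal if, for all positive initial
capitals and all strategies of the other investors, `ln r_t^i` is a submartingale.  As
`ln 0 = -∞`, integrability of `ln r_t^i` includes `r_t^i > 0` a.s., which is stated separately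
because of the convention `Real.log 0 = 0`. -/
def IsRelativeGrowthOptimal (S : Market P F N) (i : Fin M) (Λ : Rule Ω M N) : Prop :=
  IsStrategy F Λ ∧
    ∀ (y₀ : Fin M → ℝ≥0) (L : Fin M → Rule Ω M N), (∀ m, 0 < y₀ m) → L i = Λ →
      (∀ m, m ≠ i → IsStrategy F (L m)) →
        (∀ t, ∀ᵐ ω ∂P, 0 < S.relWealth L y₀ t i ω) ∧
          Submartingale (fun t ω => Real.log (S.relWealth L y₀ t i ω)) F P

/-- `ln (Y_{s+t}^m / Y_s^m)` with values in `[-∞, ∞]`, where `ln 0 = -∞` and `ln (0 / 0) = -∞`.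
(If `Y_s^m = 0` then `Y_{s+t}^m = 0`.) -/
noncomputable def logReturn (S : Market P F N) (L : Fin M → Rule Ω M N) (y₀ : Fin M → ℝ≥0)
    (s t : ℕ) (m : Fin M) (ω : Ω) : EReal :=
  ENNReal.log ((S.wealth L y₀ (s + t) m ω / S.wealth L y₀ s m ω : ℝ≥0) : ℝ≥0∞)

end Market

/-- The generalized conditional expectation `E(f⁺ | m) - E(f⁻ | m)` of an extended real random
variable.  It is meaningful where at least one of the two terms is finite; where both are infinite
its value is `-∞`, by the convention `⊤ - ⊤ = ⊥` of `EReal`. -/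
noncomputable def extCondExp {Ω : Type*} [mΩ : MeasurableSpace Ω] (P : Measure Ω)
    (m : MeasurableSpace Ω) (f : Ω → EReal) (ω : Ω) : EReal :=
  (condLExp m P (fun ω' => (f ω').toENNReal) ω : EReal)
    - (condLExp m P (fun ω' => (-f ω').toENNReal) ω : EReal)

/-! Everything follows from one fact: if investor `i` uses `Λ̂`, then `ln r^i` is a submartingale.
For any other relative growth optimal strategy this holds by definition.

To prove it, let `C` be the total wealth, `B` the total amount in the bank account, `p_n` the total
amount in asset `n`, `λ_n` the proportions of investor `i`, and `W = ζρ + |x|`. The one-step growth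
of `r^i` is at least `A / D`, where `D` is the new total wealth, `A = ζρ + ∑ q_n x_n` and `q_n = λ_n
C / p_n`; the bank term uses `ζ ≤ C (1 - ∑ λ_n)`. Write `ln (A / D) = ln (W / D) + ln (A / W)`,
apply `ln u ≥ 1 - 1/u` to each term, and bound `W / A` by Cauchy–Schwarz. The result is a growth of
at least `1 - U` with `U = (ρB + ∑ x_n p_n / (λ_n C)) / W` (`growthDefect`,
`one_sub_growthDefect_le`). This `U` is linear in `B` and the `p_n`. Under `K` the bank term has
mean at most `B / C` by the choice of `ζ`, and asset `n` has mean at most `p_n / C` by the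
definition of `Λ̂`; since `B + ∑ p_n = C`, the conditional mean of `U` is at most one
(`lintegral_growthDefect_le`).

Being nonpositive, the submartingale `ln r^i` converges, so `r^i` stays away from zero along almost
every path. Hence every wealth is at most a random constant times `Y^i`, which gives the asymptotic
claim.

For two investors, concavity of the logarithm bounds the difference of the log-returns below by
`(C_s / Y_s^m)` times the increment of `ln r^i` (`log_div_add_mul_le`). The factor is known at time
`s` and the increment has nonnegative conditional mean. As the factor is unbounded and log-returns
may be non-integrable or `-∞`, conditioning is done on positive and negative parts separately
(`extCondExp_le_of_add_mul_le`). -/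

/-! ### Disintegration along a regular conditional law -/

/-- If `κ` is a regular conditional law of `X` given `φ`, then expectations of functions of
`(φ, X)` can be computed by integrating first over `κ`. -/
theorem lintegral_eq_lintegral_lintegral_of_condLaw {Ω Ω' E : Type*} [MeasurableSpace Ω]
    [MeasurableSpace Ω'] [MeasurableSpace E] (P : Measure Ω) [IsFiniteMeasure P]
    {φ : Ω → Ω'} (hφ : Measurable φ) {X : Ω → E} (hX : Measurable X)
    (κ : Kernel Ω' E) [IsMarkovKernel κ]
    (h : ∀ A B, MeasurableSet A → MeasurableSet B →
      P (φ ⁻¹' A ∩ X ⁻¹' B) = ∫⁻ ω in φ ⁻¹' A, κ (φ ω) B ∂P)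
    {f : Ω' × E → ℝ≥0∞} (hf : Measurable f) :
    ∫⁻ ω, f (φ ω, X ω) ∂P = ∫⁻ ω, ∫⁻ x, f (φ ω, x) ∂κ (φ ω) ∂P := by
  have key : P.map (fun ω => (φ ω, X ω)) = (P.map φ) ⊗ₘ κ := by
    refine Measure.ext_prod fun {A B} hA hB => ?_
    rw [Measure.map_apply (hφ.prodMk hX) (hA.prod hB), Measure.compProd_apply_prod hA hB,
      setLIntegral_map hA (κ.measurable_coe hB) hφ, ← h A B hA hB]
    rfl
  rw [← lintegral_map hf (hφ.prodMk hX), key, Measure.lintegral_compProd hf,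
    lintegral_map hf.lintegral_kernel_prod_right' hφ]

/-- A family of probability measures with measurable evaluations, as a kernel. -/
noncomputable def kernelOfMeasurable {T E : Type*} [MeasurableSpace T] [MeasurableSpace E]
    (κ : T → ProbabilityMeasure E)
    (hκ : ∀ A, MeasurableSet A → Measurable fun τ => (κ τ : Measure E) A) : Kernel T E :=
  ⟨fun τ => κ τ, Measure.measurable_of_measurable_coe _ hκ⟩

instance instIsMarkovKernelKernelOfMeasurable {T E : Type*} [MeasurableSpace T]
    [MeasurableSpace E] (κ : T → ProbabilityMeasure E)
    (hκ : ∀ A, MeasurableSet A → Measurable fun τ => (κ τ : Measure E) A) :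
    IsMarkovKernel (kernelOfMeasurable κ hκ) :=
  ⟨fun τ => inferInstanceAs (IsProbabilityMeasure (κ τ : Measure E))⟩

theorem measurable_lintegral_of_measurable {T E : Type*} [MeasurableSpace T] [MeasurableSpace E]
    {κ : T → ProbabilityMeasure E}
    (hκ : ∀ A, MeasurableSet A → Measurable fun τ => (κ τ : Measure E) A)
    {f : T × E → ℝ≥0∞} (hf : Measurable f) :
    Measurable fun τ => ∫⁻ x, f (τ, x) ∂(κ τ : Measure E) :=
  hf.lintegral_kernel_prod_right' (κ := kernelOfMeasurable κ hκ)

/-- The disintegration with `φ` the identity from `Ω` to `Ω` equipped with `F t`. It turns pointwise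
bounds under `K` into statements about the market. -/
theorem Market.IsRegularConditionalLaw.lintegral_eq {Ω : Type*} [mΩ : MeasurableSpace Ω]
    {P : Measure Ω} [IsProbabilityMeasure P] {F : Filtration ℕ mΩ} {N : ℕ} {S : Market P F N}
    {K : ℕ → Ω → ProbabilityMeasure (Fin N → ℝ≥0)} (hK : S.IsRegularConditionalLaw K) (t : ℕ)
    {f : Ω × (Fin N → ℝ≥0) → ℝ≥0∞}
    (hf : Measurable[(F t).prod (inferInstance : MeasurableSpace (Fin N → ℝ≥0))] f) :
    ∫⁻ ω, f (ω, S.X (t + 1) ω) ∂P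
      = ∫⁻ ω, ∫⁻ x, f (ω, x) ∂(K (t + 1) ω : Measure (Fin N → ℝ≥0)) ∂P := by
  have hX : Measurable (S.X (t + 1)) := (S.adapted_X t).mono (F.le _) le_rfl
  refine @lintegral_eq_lintegral_lintegral_of_condLaw Ω Ω _ mΩ (F t) _ P _ id
    (measurable_id'' (F.le t)) _ hX
    (@kernelOfMeasurable Ω _ (F t) _ (K (t + 1)) (hK.measurable t))
    (@instIsMarkovKernelKernelOfMeasurable Ω _ (F t) _ (K (t + 1)) (hK.measurable t)) ?_ f hf
  intro A B hA hB
  have hA' : MeasurableSet A := F.le t A hA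
  have hXB : MeasurableSet (S.X (t + 1) ⁻¹' B) := hX hB
  have hi : Integrable ((S.X (t + 1) ⁻¹' B).indicator fun _ => (1 : ℝ)) P :=
    (integrable_const 1).indicator hXB
  have h1 : ∫ ω in A, (K (t + 1) ω : Measure (Fin N → ℝ≥0)).real B ∂P
      = P.real (A ∩ S.X (t + 1) ⁻¹' B) := by
    rw [setIntegral_congr_ae hA' ((hK.condProb t B hB).mono fun ω h _ => h),
      setIntegral_condExp (F.le t) hi hA, setIntegral_indicator hXB]
    simp
  have hm : Measurable fun ω => (K (t + 1) ω : Measure (Fin N → ℝ≥0)) B :=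
    (hK.measurable t B hB).mono (F.le t) le_rfl
  have h2 : ∫ ω in A, (K (t + 1) ω : Measure (Fin N → ℝ≥0)).real B ∂P
      = (∫⁻ ω in A, (K (t + 1) ω : Measure (Fin N → ℝ≥0)) B ∂P).toReal :=
    integral_toReal hm.aemeasurable (ae_of_all _ fun _ => measure_lt_top _ _)
  have h3 : ∫⁻ ω in A, (K (t + 1) ω : Measure (Fin N → ℝ≥0)) B ∂P ≠ ∞ := by
    refine ne_top_of_le_ne_top (measure_ne_top P A) ?_
    calc _ ≤ ∫⁻ _ in A, 1 ∂P := lintegral_mono fun _ => prob_le_one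
      _ = P A := by simp
  rw [h2] at h1
  exact ((ENNReal.toReal_eq_toReal_iff' h3 (measure_ne_top _ _)).1 h1).symm

/-! ### The function `ζ` and the proportions of `Λ̂` -/

section Zeta

variable {N : ℕ} (ρ : ℝ≥0) (κ : ProbabilityMeasure (Fin N → ℝ≥0)) (c : ℝ≥0)

/-- The function `z ↦ ∫ c ρ / (z ρ + |x|) κ(dx)`. -/
noncomputable def bankIntegral (z : ℝ≥0) : ℝ≥0∞ :=
  ∫⁻ x, ((c * ρ : ℝ≥0) : ℝ≥0∞) / ((z * ρ + ∑ n, x n : ℝ≥0) : ℝ≥0∞)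
    ∂(κ : Measure (Fin N → ℝ≥0))

theorem bankIntegral_antitone : Antitone (bankIntegral ρ κ c) := fun z z' h =>
  lintegral_mono fun x => ENNReal.div_le_div_left (by gcongr) _

theorem inGamma_iff : InGamma ρ κ c ↔ 1 < bankIntegral ρ κ c 0 := by
  simp [InGamma, bankIntegral]

theorem tendsto_bankIntegrand (z : ℝ≥0) (x : Fin N → ℝ≥0) :
    Tendsto (fun z : ℝ≥0 => ((c * ρ : ℝ≥0) : ℝ≥0∞) / ((z * ρ + ∑ n, x n : ℝ≥0) : ℝ≥0∞))
      (nhds z) (nhds (((c * ρ : ℝ≥0) : ℝ≥0∞) / ((z * ρ + ∑ n, x n : ℝ≥0) : ℝ≥0∞))) := by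
  refine ENNReal.Tendsto.const_div (ENNReal.tendsto_coe.2 ?_) (Or.inr ENNReal.coe_ne_top)
  exact Continuous.tendsto (by fun_prop) z

theorem measurable_bankIntegrand (z : ℝ≥0) :
    Measurable fun x : Fin N → ℝ≥0 =>
      ((c * ρ : ℝ≥0) : ℝ≥0∞) / ((z * ρ + ∑ n, x n : ℝ≥0) : ℝ≥0∞) := by
  fun_prop

theorem bankIntegrand_le {z z' : ℝ≥0} (hρ : ρ ≠ 0) (hz : z ≠ 0) (h : z ≤ z')
    (x : Fin N → ℝ≥0) :
    ((c * ρ : ℝ≥0) : ℝ≥0∞) / ((z' * ρ + ∑ n, x n : ℝ≥0) : ℝ≥0∞) ≤ ((c / z : ℝ≥0) : ℝ≥0∞) := by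
  have h0 : z' * ρ + ∑ n, x n ≠ 0 :=
    (add_pos_of_pos_of_nonneg (mul_pos ((pos_of_ne_zero hz).trans_le h)
      (pos_of_ne_zero hρ)) (zero_le)).ne'
  rw [← ENNReal.coe_div h0]
  refine ENNReal.coe_le_coe.2 ?_
  rw [div_le_div_iff₀ (pos_of_ne_zero h0) (pos_of_ne_zero hz)]
  calc c * ρ * z = c * (z * ρ) := by ring
    _ ≤ c * (z' * ρ + ∑ n, x n) := by
      gcongr
      exact (mul_le_mul_left h ρ).trans le_self_add

/-- Near a positive `z` the integrand is dominated by the constant `c / (z / 2)`. No such bound is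
available at zero, where Fatou's lemma is used instead. -/
theorem continuousAt_bankIntegral (hρ : ρ ≠ 0) {z : ℝ≥0} (hz : z ≠ 0) :
    ContinuousAt (bankIntegral ρ κ c) z := by
  refine tendsto_lintegral_filter_of_dominated_convergence
    (fun _ => ((c / (z / 2) : ℝ≥0) : ℝ≥0∞)) (Eventually.of_forall fun z' => by fun_prop) ?_ ?_ ?_
  · have hlt : z / 2 < z := NNReal.half_lt_self hz
    filter_upwards [lt_mem_nhds hlt] with z' hz'
    exact ae_of_all _ (bankIntegrand_le ρ c hρ (by simpa using hz) hz'.le)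
  · simp
  · exact ae_of_all _ (tendsto_bankIntegrand ρ c z)

theorem bankIntegral_self_le : bankIntegral ρ κ c c ≤ 1 := by
  calc bankIntegral ρ κ c c ≤ ∫⁻ _, 1 ∂(κ : Measure (Fin N → ℝ≥0)) := by
        refine lintegral_mono fun x => ENNReal.div_le_of_le_mul ?_
        rw [one_mul]
        exact ENNReal.coe_le_coe.2 le_self_add
    _ = 1 := by simp

/-- Intermediate value theorem: the integral is at most one at `c` and exceeds one at some small
positive point. -/
theorem exists_solvesZeta (h : InGamma ρ κ c) : ∃ z, SolvesZeta ρ κ c z := by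
  rw [inGamma_iff] at h
  have hcρ : c * ρ ≠ 0 := by
    intro h0
    simp [bankIntegral, h0] at h
  have hρ : ρ ≠ 0 := right_ne_zero_of_mul hcρ
  -- If all these integrals were at most one, Fatou along `1 / (n + 1) → 0` would give the same
  -- bound at zero.
  obtain ⟨n, hn⟩ : ∃ n : ℕ, 1 < bankIntegral ρ κ c (1 / ((n : ℝ≥0) + 1)) := by
    by_contra! hcon
    refine h.not_ge ?_
    have hlim : Tendsto (fun n : ℕ => 1 / ((n : ℝ≥0) + 1)) atTop (nhds 0) :=
      tendsto_one_div_add_atTop_nhds_zero_nat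
    calc bankIntegral ρ κ c 0
        = ∫⁻ x, liminf (fun n : ℕ => ((c * ρ : ℝ≥0) : ℝ≥0∞)
            / ((1 / ((n : ℝ≥0) + 1) * ρ + ∑ n, x n : ℝ≥0) : ℝ≥0∞)) atTop
            ∂(κ : Measure (Fin N → ℝ≥0)) :=
          lintegral_congr fun x =>
            (((tendsto_bankIntegrand ρ c 0 x).comp hlim).liminf_eq).symm
      _ ≤ liminf (fun n : ℕ => bankIntegral ρ κ c (1 / ((n : ℝ≥0) + 1))) atTop :=
          lintegral_liminf_le fun n => measurable_bankIntegrand ρ c _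
      _ ≤ liminf (fun _ : ℕ => (1 : ℝ≥0∞)) atTop :=
          liminf_le_liminf (Eventually.of_forall hcon)
      _ = 1 := by simp
  set z₀ : ℝ≥0 := 1 / ((n : ℝ≥0) + 1) with hz₀
  have hz₀pos : 0 < z₀ := by positivity
  have hle : z₀ ≤ c := by
    by_contra! hlt
    exact ((bankIntegral_antitone ρ κ c hlt.le).trans (bankIntegral_self_le ρ κ c)).not_gt hn
  obtain ⟨z, hz, hz1⟩ := intermediate_value_Icc' hle
    (fun z hz => (continuousAt_bankIntegral ρ κ c hρ
      (hz₀pos.trans_le hz.1).ne').continuousWithinAt)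
    (show (1 : ℝ≥0∞) ∈ Set.Icc _ _ from ⟨bankIntegral_self_le ρ κ c, hn.le⟩)
  exact ⟨z, hz₀pos.trans_le hz.1, hz.2, hz1⟩

theorem solvesZeta_zeta (h : InGamma ρ κ c) : SolvesZeta ρ κ c (zeta ρ κ c) := by
  have h' : InGamma ρ κ c ∧ ∃ z, SolvesZeta ρ κ c z := ⟨h, exists_solvesZeta ρ κ c h⟩
  rw [zeta, dif_pos h']
  exact h'.2.choose_spec

theorem zeta_eq_zero (h : ¬ InGamma ρ κ c) : zeta ρ κ c = 0 := by
  rw [zeta, dif_neg fun h' => h h'.1]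

/-- By strict decrease of the integral below the root. Covering both cases of the definition, this
removes the choice from `zeta` and yields both its measurability and `bankIntegral_zeta_le`. -/
theorem lt_zeta_iff (z : ℝ≥0) : z < zeta ρ κ c ↔ 1 < bankIntegral ρ κ c z := by
  by_cases h : InGamma ρ κ c
  · obtain ⟨hpos, hle, heq⟩ := solvesZeta_zeta ρ κ c h
    refine ⟨fun hz => ?_, fun hz => ?_⟩
    · have hcρ : c * ρ ≠ 0 := by
        intro h0
        simp [h0] at heq
      have hρ : 0 < ρ := pos_of_ne_zero (right_ne_zero_of_mul hcρ)
      rw [← heq]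
      refine lintegral_strict_mono (IsProbabilityMeasure.ne_zero _)
        (measurable_bankIntegrand ρ c z).aemeasurable (by rw [heq]; simp)
        (ae_of_all _ fun x => ENNReal.div_lt_div_left (by simpa using hcρ)
          ENNReal.coe_ne_top (ENNReal.coe_lt_coe.2 ?_))
      gcongr
    · by_contra! hcon
      exact ((bankIntegral_antitone ρ κ c hcon).trans heq.le).not_gt hz
  · rw [zeta_eq_zero ρ κ c h]
    rw [inGamma_iff, not_lt] at h
    exact ⟨fun hz => absurd hz not_lt_zero, fun hz =>
      absurd hz ((bankIntegral_antitone ρ κ c zero_le).trans h).not_gt⟩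

theorem bankIntegral_zeta_le : bankIntegral ρ κ c (zeta ρ κ c) ≤ 1 :=
  not_lt.1 fun h => lt_irrefl _ ((lt_zeta_iff ρ κ c _).2 h)

theorem measurable_hatIntegrand (a : ℝ≥0) (n : Fin N) :
    Measurable fun x : Fin N → ℝ≥0 => (x n : ℝ≥0∞) / ((a + ∑ k, x k : ℝ≥0) : ℝ≥0∞) := by
  fun_prop

theorem coe_hatProportion (a : ℝ≥0) (n : Fin N) :
    (hatProportion a κ n : ℝ≥0∞)
      = ∫⁻ x, (x n : ℝ≥0∞) / ((a + ∑ k, x k : ℝ≥0) : ℝ≥0∞) ∂(κ : Measure (Fin N → ℝ≥0)) := by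
  refine ENNReal.coe_toNNReal (ne_top_of_le_ne_top ENNReal.one_ne_top ?_)
  calc _ ≤ ∫⁻ _, 1 ∂(κ : Measure (Fin N → ℝ≥0)) := by
        refine lintegral_mono fun x => ENNReal.div_le_of_le_mul ?_
        rw [one_mul]
        refine ENNReal.coe_le_coe.2 (le_add_left ?_)
        exact Finset.single_le_sum (f := x) (fun _ _ => zero_le) (Finset.mem_univ n)
    _ = 1 := by simp

/-- The amount `ζ` does not exceed the amount which `Λ̂` keeps in the bank account per unit of
relative wealth. -/
theorem zeta_add_mul_sum_hatProportion_le :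
    zeta ρ κ c + c * ∑ n, hatProportion (zeta ρ κ c * ρ) κ n ≤ c := by
  by_cases h : InGamma ρ κ c
  · obtain ⟨hpos, hle, heq⟩ := solvesZeta_zeta ρ κ c h
    set z := zeta ρ κ c
    rw [← ENNReal.coe_le_coe]
    push_cast
    simp_rw [coe_hatProportion]
    rw [← lintegral_finsetSum _ (fun n _ => measurable_hatIntegrand (z * ρ) n)]
    -- The equation for `z` lets `z` be written as an integral, so that the claim can be checked
    -- under the integral sign via `z * (c * ρ) + c * |x| = c * (z * ρ + |x|)`.
    have hz : (z : ℝ≥0∞) = ∫⁻ x, z * (((c * ρ : ℝ≥0) : ℝ≥0∞)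
        / ((z * ρ + ∑ n, x n : ℝ≥0) : ℝ≥0∞)) ∂(κ : Measure (Fin N → ℝ≥0)) := by
      rw [lintegral_const_mul _ (by fun_prop), heq, mul_one]
    calc _ = ∫⁻ x, z * (((c * ρ : ℝ≥0) : ℝ≥0∞)
            / ((z * ρ + ∑ n, x n : ℝ≥0) : ℝ≥0∞)) ∂(κ : Measure (Fin N → ℝ≥0))
          + ∫⁻ x, c * ∑ n, (x n : ℝ≥0∞) / ((z * ρ + ∑ k, x k : ℝ≥0) : ℝ≥0∞)
            ∂(κ : Measure (Fin N → ℝ≥0)) := by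
          rw [lintegral_const_mul (c : ℝ≥0∞) (by fun_prop), ← hz]
      _ ≤ ∫⁻ _, c ∂(κ : Measure (Fin N → ℝ≥0)) := by
          rw [← lintegral_add_left (by fun_prop)]
          refine lintegral_mono fun x => ?_
          simp only [div_eq_mul_inv]
          rw [← Finset.sum_mul, ← mul_assoc, ← mul_assoc, ← add_mul, ← div_eq_mul_inv]
          refine ENNReal.div_le_of_le_mul (le_of_eq ?_)
          push_cast
          ring
      _ = c := by simp
  · rw [zeta_eq_zero ρ κ c h, zero_add]
    exact mul_le_of_le_one_right' (sum_hatProportion_le_one _ κ)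

end Zeta

/-! ### Measurable dependence of `ζ` and of the proportions on parameters -/

section ZetaMeasurable

variable {T : Type*} [MeasurableSpace T] {N : ℕ} {κ : T → ProbabilityMeasure (Fin N → ℝ≥0)}

theorem Measurable.zeta
    (hκ : ∀ A, MeasurableSet A → Measurable fun τ => (κ τ : Measure (Fin N → ℝ≥0)) A)
    {ρ c : T → ℝ≥0} (hρ : Measurable ρ) (hc : Measurable c) :
    Measurable fun τ => _root_.zeta (ρ τ) (κ τ) (c τ) := by
  refine measurable_of_Ioi fun z => ?_
  simp only [Set.preimage, Set.mem_Ioi, lt_zeta_iff]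
  refine measurableSet_lt measurable_const ?_
  exact measurable_lintegral_of_measurable hκ
    (f := fun p => ((c p.1 * ρ p.1 : ℝ≥0) : ℝ≥0∞) / ((z * ρ p.1 + ∑ n, p.2 n : ℝ≥0) : ℝ≥0∞))
    (by fun_prop)

theorem Measurable.hatProportion
    (hκ : ∀ A, MeasurableSet A → Measurable fun τ => (κ τ : Measure (Fin N → ℝ≥0)) A)
    {a : T → ℝ≥0} (ha : Measurable a) :
    Measurable fun τ => _root_.hatProportion (a τ) (κ τ) := by
  refine measurable_pi_lambda _ fun n => Measurable.ennreal_toNNReal ?_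
  exact measurable_lintegral_of_measurable hκ
    (f := fun p => (p.2 n : ℝ≥0∞) / ((a p.1 + ∑ k, p.2 k : ℝ≥0) : ℝ≥0∞)) (by fun_prop)

end ZetaMeasurable

/-! ### Measurability of the wealth process -/

theorem Measurable.wealthStep {T : Type*} [MeasurableSpace T] {M N : ℕ} {ρ : T → ℝ≥0}
    {x : T → Fin N → ℝ≥0} {l : T → JointProportions M N} {y : T → Fin M → ℝ≥0}
    (hρ : Measurable ρ) (hx : Measurable x) (hl : Measurable l) (hy : Measurable y) :
    Measurable fun τ => _root_.wealthStep (ρ τ) (x τ) (l τ) (y τ) := by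
  have hl' : ∀ m n, Measurable fun τ => (l τ m).1 n := fun m n =>
    (measurable_pi_apply n).comp (measurable_subtype_coe.comp ((measurable_pi_apply m).comp hl))
  have hy' : ∀ m, Measurable fun τ => y τ m := fun m => (measurable_pi_apply m).comp hy
  have hx' : ∀ n, Measurable fun τ => x τ n := fun n => (measurable_pi_apply n).comp hx
  refine measurable_pi_lambda _ fun m => ?_
  unfold _root_.wealthStep
  fun_prop

namespace Market

variable {Ω : Type*} [mΩ : MeasurableSpace Ω] {P : Measure Ω} {F : Filtration ℕ mΩ} {M N : ℕ}

theorem measurable_wealthOfHistory (S : Market P F N) {T : Type*} [mT : MeasurableSpace T]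
    {φ : T → Ω} {y : T → Fin M → ℝ≥0} (hy : Measurable y) :
    ∀ (t : ℕ) {h : T → Fin t → JointProportions M N}, Measurable[mT, F t] φ → Measurable h →
      Measurable fun τ => S.wealthOfHistory (φ τ) (y τ) t (h τ)
  | 0, _, _, _ => hy
  | t + 1, h, hφ, hh => by
    have hφ' : Measurable[mT, F t] φ := hφ.mono le_rfl (F.mono t.le_succ)
    refine Measurable.wealthStep (((S.predictable_ρ t)).comp hφ') ((S.adapted_X t).comp hφ)
      ((measurable_pi_apply _).comp hh) ?_
    exact measurable_wealthOfHistory S hy t hφ'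
      (measurable_pi_lambda _ fun s => (measurable_pi_apply _).comp hh)

theorem isStrategy_hatRule {S : Market P F N} {K : ℕ → Ω → ProbabilityMeasure (Fin N → ℝ≥0)}
    (hK : S.IsRegularConditionalLaw K) :
    IsStrategy F (S.hatRule K : Rule Ω M N) := by
  intro t
  let mT : MeasurableSpace (Ω × ((Fin M → ℝ≥0) × (Fin t → JointProportions M N))) :=
    (F t).prod inferInstance
  have hfst : Measurable[mT, F t] Prod.fst := @measurable_fst _ _ (F t) _
  have hsnd : Measurable[mT] Prod.snd := @measurable_snd _ _ (F t) _
  have hκ : ∀ A, MeasurableSet A → Measurable[mT] fun p =>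
      (K (t + 1) p.1 : Measure (Fin N → ℝ≥0)) A := fun A hA => (hK.measurable t A hA).comp hfst
  have hρ : Measurable[mT] fun p => S.ρ (t + 1) p.1 := (S.predictable_ρ t).comp hfst
  have hw : Measurable[mT] fun p => S.wealthOfHistory p.1 p.2.1 t p.2.2 :=
    S.measurable_wealthOfHistory (measurable_fst.comp hsnd) t hfst (measurable_snd.comp hsnd)
  have hC : Measurable[mT] fun p => ∑ m, S.wealthOfHistory p.1 p.2.1 t p.2.2 m :=
    Finset.measurable_sum _ fun m _ => (measurable_pi_apply m).comp hw
  exact Measurable.subtype_mk (Measurable.hatProportion hκ ((Measurable.zeta hκ hρ hC).mul hρ))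

end Market

/-! ### Realized proportions and wealth: adaptedness and the wealth recursion -/

section Realization

variable {Ω : Type*} [mΩ : MeasurableSpace Ω] {P : Measure Ω} {F : Filtration ℕ mΩ} {M N : ℕ}

/-- The joint proportions `λ_{t+1}` realized when the investors use the profile `L`. -/
def realizedProportions (L : Fin M → Rule Ω M N) (y₀ : Fin M → ℝ≥0) (t : ℕ) (ω : Ω) :
    JointProportions M N :=
  fun m => L m t ω y₀ (realization L y₀ ω t)

theorem IsStrategy.measurable_apply {Λ : Rule Ω M N} (hΛ : IsStrategy F Λ) (y₀ : Fin M → ℝ≥0)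
    {t : ℕ} {h : Ω → Fin t → JointProportions M N} (hh : Measurable[F t] h) :
    Measurable[F t] fun ω => Λ t ω y₀ (h ω) :=
  (hΛ t).comp (@Measurable.prodMk _ (F t) _ _ (F t) _ id _ (@measurable_id _ (F t))
    (Measurable.prodMk (measurable_const (a := y₀)) hh))

theorem measurable_realization {L : Fin M → Rule Ω M N} (hL : ∀ m, IsStrategy F (L m))
    (y₀ : Fin M → ℝ≥0) : ∀ t, Measurable[F t] fun ω => realization L y₀ ω t
  | 0 => @measurable_pi_lambda _ _ _ (F 0) _ _ fun s => s.elim0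
  | t + 1 => by
    have ih := measurable_realization hL y₀ t
    refine Measurable.mono ?_ (F.mono t.le_succ) le_rfl
    refine @measurable_pi_lambda _ _ _ (F t) _ _ fun s => ?_
    refine Fin.lastCases ?_ (fun s => ?_) s
    · simp only [realization, Fin.snoc_last]
      exact @measurable_pi_lambda _ _ _ (F t) _ _ fun m => (hL m).measurable_apply y₀ ih
    · simp only [realization, Fin.snoc_castSucc]
      exact (measurable_pi_apply s).comp ih

theorem measurable_realizedProportions {L : Fin M → Rule Ω M N} (hL : ∀ m, IsStrategy F (L m))
    (y₀ : Fin M → ℝ≥0) (t : ℕ) : Measurable[F t] (realizedProportions L y₀ t) :=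
  @measurable_pi_lambda _ _ _ (F t) _ _ fun m =>
    (hL m).measurable_apply y₀ (measurable_realization hL y₀ t)

theorem Market.measurable_wealth (S : Market P F N) {L : Fin M → Rule Ω M N}
    (hL : ∀ m, IsStrategy F (L m)) (y₀ : Fin M → ℝ≥0) (t : ℕ) :
    Measurable[F t] fun ω m => S.wealth L y₀ t m ω :=
  @measurable_wealthOfHistory Ω mΩ P F M N S Ω (F t) id _ measurable_const t _
    (@measurable_id _ (F t)) (measurable_realization hL y₀ t)

theorem Market.measurable_wealth_apply (S : Market P F N) {L : Fin M → Rule Ω M N}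
    (hL : ∀ m, IsStrategy F (L m)) (y₀ : Fin M → ℝ≥0) (t : ℕ) (m : Fin M) :
    Measurable[F t] (S.wealth L y₀ t m) :=
  (measurable_pi_apply m).comp (S.measurable_wealth hL y₀ t)

theorem Market.measurable_relWealth (S : Market P F N) {L : Fin M → Rule Ω M N}
    (hL : ∀ m, IsStrategy F (L m)) (y₀ : Fin M → ℝ≥0) (t : ℕ) (m : Fin M) :
    Measurable[F t] (S.relWealth L y₀ t m) :=
  (S.measurable_wealth_apply hL y₀ t m).div
    (Finset.measurable_sum _ fun k _ => S.measurable_wealth_apply hL y₀ t k)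

theorem Market.wealth_zero (S : Market P F N) (L : Fin M → Rule Ω M N) (y₀ : Fin M → ℝ≥0)
    (m : Fin M) (ω : Ω) : S.wealth L y₀ 0 m ω = y₀ m := rfl

theorem Market.wealth_succ (S : Market P F N) (L : Fin M → Rule Ω M N) (y₀ : Fin M → ℝ≥0)
    (t : ℕ) (m : Fin M) (ω : Ω) :
    S.wealth L y₀ (t + 1) m ω = wealthStep (S.ρ (t + 1) ω) (S.X (t + 1) ω)
      (realizedProportions L y₀ t ω) (fun k => S.wealth L y₀ t k ω) m := by
  simp only [wealth, wealthOfHistory, realization, Fin.snoc_last, Fin.snoc_castSucc]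
  rfl

theorem Market.relWealth_le_one (S : Market P F N) (L : Fin M → Rule Ω M N) (y₀ : Fin M → ℝ≥0)
    (t : ℕ) (m : Fin M) (ω : Ω) : S.relWealth L y₀ t m ω ≤ 1 :=
  div_le_one_of_le₀ (Finset.single_le_sum (f := fun k => S.wealth L y₀ t k ω)
    (fun _ _ => zero_le) (Finset.mem_univ m)) zero_le

end Realization

/-! ### One step of the wealth equation -/

section OneStep

variable {M N : ℕ} (ρ : ℝ≥0) (x : Fin N → ℝ≥0) (l : JointProportions M N) (y : Fin M → ℝ≥0)

/-- The total amount kept in the bank account. -/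
noncomputable def bankTotal : ℝ≥0 := ∑ k, (1 - ∑ n, (l k).1 n) * y k

/-- The total amount invested in asset `n`. -/
noncomputable def assetTotal (n : Fin N) : ℝ≥0 := ∑ k, (l k).1 n * y k

theorem bankTotal_add_sum_assetTotal :
    bankTotal l y + ∑ n, assetTotal l y n = ∑ k, y k := by
  unfold bankTotal assetTotal
  rw [Finset.sum_comm, ← Finset.sum_add_distrib]
  refine Finset.sum_congr rfl fun k _ => ?_
  rw [← Finset.sum_mul, ← add_mul, tsub_add_cancel_of_le (l k).2, one_mul]

/-- Only an inequality, because the payoff of an asset in which nobody invests is lost (`0 / 0 =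
0`). -/
theorem sum_wealthStep_le :
    ∑ m, wealthStep ρ x l y m ≤ ρ * bankTotal l y + ∑ n, x n := by
  unfold wealthStep
  rw [Finset.sum_add_distrib]
  refine add_le_add (le_of_eq ?_)
    (Finset.sum_comm.trans_le (Finset.sum_le_sum fun n _ => ?_))
  · rw [bankTotal, Finset.mul_sum]
    exact Finset.sum_congr rfl fun k _ => mul_assoc _ _ _
  · rw [← Finset.sum_mul, ← Finset.sum_div]
    exact mul_le_of_le_one_left' (div_self_le_one _)

theorem sum_wealthStep_le' : ∑ m, wealthStep ρ x l y m ≤ ρ * ∑ k, y k + ∑ n, x n := by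
  refine (sum_wealthStep_le ρ x l y).trans ?_
  gcongr
  rw [← bankTotal_add_sum_assetTotal l y]
  exact le_self_add

/-- A lower bound for `log (A / D)`, where `A = w + ∑ qₙ xₙ`: combine `log u ≥ 1 - 1 / u` and
the Cauchy–Schwarz inequality. -/
theorem two_sub_le_log_sub_log {ι : Type*} [Fintype ι] {w D : ℝ} {x q : ι → ℝ} (hw : 0 ≤ w)
    (hx : ∀ n, 0 ≤ x n) (hq : ∀ n, 0 ≤ q n) (hxq : ∀ n, q n = 0 → x n = 0)
    (hW : 0 < w + ∑ n, x n) (hD : 0 < D) :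
    0 < w + ∑ n, q n * x n ∧
    2 - D / (w + ∑ n, x n) - (w + ∑ n, x n / q n) / (w + ∑ n, x n)
      ≤ Real.log (w + ∑ n, q n * x n) - Real.log D := by
  set W := w + ∑ n, x n with hWdef
  set A := w + ∑ n, q n * x n with hAdef
  have hCS : W ^ 2 ≤ A * (w + ∑ n, x n / q n) := by
    -- The bank term `w` enters as one more asset, with index `none` and coefficient one.
    have := Finset.sum_sq_le_sum_mul_sum_of_sq_le_mul (Finset.univ : Finset (Option ι))
      (r := fun o => o.elim w x) (f := fun o => o.elim w fun n => q n * x n)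
      (g := fun o => o.elim w fun n => x n / q n) ?_ ?_ ?_
    · simpa [Fintype.sum_option] using this
    · rintro (_ | n) _
      · exact hw
      · exact mul_nonneg (hq n) (hx n)
    · rintro (_ | n) _
      · exact hw
      · exact div_nonneg (hx n) (hq n)
    · rintro (_ | n) _
      · simp [sq]
      · by_cases h : q n = 0
        · simp [h, hxq n h]
        · simp only [Option.elim]
          exact le_of_eq (by field_simp)
  have hA0 : 0 ≤ A := add_nonneg hw (Finset.sum_nonneg fun n _ => mul_nonneg (hq n) (hx n))
  have hA : 0 < A := by
    refine lt_of_le_of_ne hA0 fun h => ?_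
    rw [← h, zero_mul] at hCS
    exact (pow_pos hW 2).not_ge hCS
  refine ⟨hA, ?_⟩
  have h1 : 1 - D / W ≤ Real.log W - Real.log D := by
    rw [← Real.log_div hW.ne' hD.ne']
    simpa using Real.one_sub_inv_le_log_of_pos (div_pos hW hD)
  have h2 : 1 - W / A ≤ Real.log A - Real.log W := by
    rw [← Real.log_div hA.ne' hW.ne']
    simpa using Real.one_sub_inv_le_log_of_pos (div_pos hA hW)
  have h3 : W / A ≤ (w + ∑ n, x n / q n) / W := by
    rw [div_le_div_iff₀ hA hW]
    nlinarith
  linarith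

variable (i : Fin M) (ζ : ℝ≥0)

/-- A random variable `U` of conditional mean at most one such that the logarithm of the relative
wealth of investor `i` grows by at least `1 - U` in one step, if this investor uses `Λ̂`. -/
noncomputable def growthDefect : ℝ≥0 :=
  (ρ * bankTotal l y + ∑ n, x n * (assetTotal l y n / ((l i).1 n * ∑ k, y k)))
    / (ζ * ρ + ∑ n, x n)

/-- Apply `two_sub_le_log_sub_log` with `w = ζρ` and `D` the new total wealth. Since `D ≤ ρ *
bankTotal + |x|`, the two subtracted quotients add up to at most `1 + growthDefect`: the part `(ζρ +
|x|) / W` of the numerators equals one. -/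
theorem one_sub_growthDefect_le (hy : 0 < y i) (hW : 0 < ζ * ρ + ∑ n, x n)
    (hζ : ζ + (∑ k, y k) * ∑ n, (l i).1 n ≤ ∑ k, y k) (hx : ∀ n, (l i).1 n = 0 → x n = 0) :
    0 < wealthStep ρ x l y i ∧
      1 - (growthDefect ρ x l y i ζ : ℝ)
        ≤ Real.log ((wealthStep ρ x l y i / ∑ k, wealthStep ρ x l y k : ℝ≥0) : ℝ)
          - Real.log ((y i / ∑ k, y k : ℝ≥0) : ℝ) := by
  set C : ℝ≥0 := ∑ k, y k with hC
  have hyC : y i ≤ C := Finset.single_le_sum (f := y) (fun _ _ => zero_le) (Finset.mem_univ i)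
  have hCpos : 0 < C := hy.trans_le hyC
  set Y := wealthStep ρ x l y i with hY
  set D := ∑ k, wealthStep ρ x l y k with hD
  have hYD : Y ≤ D :=
    Finset.single_le_sum (f := wealthStep ρ x l y) (fun _ _ => zero_le) (Finset.mem_univ i)
  have hp : ∀ n, (l i).1 n * y i ≤ assetTotal l y n := fun n =>
    Finset.single_le_sum (f := fun k => (l k).1 n * y k) (fun _ _ => zero_le)
      (Finset.mem_univ i)
  -- The ratio of the proportion of investor `i` in asset `n` to the wealth-weighted mean proportion
  -- of all investors.
  let q : Fin N → ℝ≥0 := fun n => (l i).1 n * C / assetTotal l y n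
  have hq0 : ∀ n, q n = 0 → x n = 0 := by
    intro n hn
    refine hx n ?_
    by_contra h0
    have : 0 < (l i).1 n * y i := mul_pos (pos_of_ne_zero h0) hy
    exact (div_pos (mul_pos (pos_of_ne_zero h0) hCpos) (this.trans_le (hp n))).ne' hn
  have hζ' : ζ ≤ C * (1 - ∑ n, (l i).1 n) := by
    rw [mul_tsub, mul_one]
    exact le_tsub_of_add_le_right hζ
  -- The asset terms agree exactly; only the bank term is estimated.
  have hA : ζ * ρ + ∑ n, q n * x n ≤ Y * C / y i := by
    rw [le_div_iff₀ hy, hY, wealthStep, add_mul, add_mul]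
    refine add_le_add ?_ (le_of_eq ?_)
    · calc ζ * ρ * y i ≤ C * (1 - ∑ n, (l i).1 n) * ρ * y i := by gcongr
        _ = _ := by ring
    · rw [Finset.sum_mul, Finset.sum_mul]
      refine Finset.sum_congr rfl fun n _ => ?_
      change (l i).1 n * C / assetTotal l y n * x n * y i
        = (l i).1 n * y i / assetTotal l y n * x n * C
      ring
  have hbase : ∀ D' : ℝ, 0 < D' → _ := fun D' hD' =>
    two_sub_le_log_sub_log (w := ((ζ * ρ : ℝ≥0) : ℝ)) (x := fun n => (x n : ℝ))
      (q := fun n => (q n : ℝ)) (NNReal.coe_nonneg _) (fun n => NNReal.coe_nonneg _)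
      (fun n => NNReal.coe_nonneg _) (fun n h => by simpa using hq0 n (by simpa using h))
      (by exact_mod_cast hW) hD'
  have hApos : 0 < ζ * ρ + ∑ n, q n * x n := by exact_mod_cast (hbase 1 one_pos).1
  have hYpos : 0 < Y := by
    refine pos_of_ne_zero fun h0 => ?_
    rw [h0, zero_mul, zero_div] at hA
    exact hApos.not_ge hA
  refine ⟨hYpos, ?_⟩
  have hDpos : 0 < D := hYpos.trans_le hYD
  have hmain := (hbase D (by exact_mod_cast hDpos)).2
  have hlog : Real.log ((Y / D : ℝ≥0) : ℝ) - Real.log ((y i / C : ℝ≥0) : ℝ)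
      = Real.log ((Y * C / y i : ℝ≥0) : ℝ) - Real.log (D : ℝ) := by
    have h1 : (Y : ℝ) ≠ 0 := by exact_mod_cast hYpos.ne'
    have h2 : (D : ℝ) ≠ 0 := by exact_mod_cast hDpos.ne'
    have h3 : (C : ℝ) ≠ 0 := by exact_mod_cast hCpos.ne'
    have h4 : (y i : ℝ) ≠ 0 := by exact_mod_cast hy.ne'
    push_cast
    rw [Real.log_div h1 h2, Real.log_div h4 h3, Real.log_div (mul_ne_zero h1 h3) h4,
      Real.log_mul h1 h3]
    ring
  rw [hlog]
  have hlogA : Real.log (((ζ * ρ : ℝ≥0) : ℝ) + ∑ n, (q n : ℝ) * x n)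
      ≤ Real.log ((Y * C / y i : ℝ≥0) : ℝ) :=
    Real.log_le_log (by exact_mod_cast hApos) (by exact_mod_cast hA)
  refine le_trans ?_ (hmain.trans (sub_le_sub_right hlogA _))
  have hWr : (0 : ℝ) < ((ζ * ρ : ℝ≥0) : ℝ) + ∑ n, (x n : ℝ) := by exact_mod_cast hW
  have hDle : (D : ℝ) ≤ ρ * bankTotal l y + ∑ n, (x n : ℝ) := by
    exact_mod_cast sum_wealthStep_le ρ x l y
  have hU : (growthDefect ρ x l y i ζ : ℝ)
      = ((ρ : ℝ) * bankTotal l y + ∑ n, (x n : ℝ) / (q n : ℝ))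
        / (((ζ * ρ : ℝ≥0) : ℝ) + ∑ n, (x n : ℝ)) := by
    have : ∀ n, (x n : ℝ) / (q n : ℝ)
        = ((x n * (assetTotal l y n / ((l i).1 n * C)) : ℝ≥0) : ℝ) := by
      intro n
      rw [← NNReal.coe_div]
      simp only [q, div_div_eq_mul_div]
      rw [mul_div_assoc]
    simp only [this]
    rw [growthDefect]
    push_cast [hC]
    rfl
  rw [hU, ← sub_nonneg]
  have : (2 - (D : ℝ) / (((ζ * ρ : ℝ≥0) : ℝ) + ∑ n, (x n : ℝ))
      - (((ζ * ρ : ℝ≥0) : ℝ) + ∑ n, (x n : ℝ) / (q n : ℝ))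
        / (((ζ * ρ : ℝ≥0) : ℝ) + ∑ n, (x n : ℝ)))
      - (1 - ((ρ : ℝ) * bankTotal l y + ∑ n, (x n : ℝ) / (q n : ℝ))
        / (((ζ * ρ : ℝ≥0) : ℝ) + ∑ n, (x n : ℝ)))
      = ((ρ : ℝ) * bankTotal l y + ∑ n, (x n : ℝ) - D)
        / (((ζ * ρ : ℝ≥0) : ℝ) + ∑ n, (x n : ℝ)) := by
    field_simp
    ring
  rw [this]
  exact div_nonneg (by linarith) hWr.le

/-- The weights `p_n / (λ_n C)` cancel against the means `λ_n` of `xⁿ / (ζρ + |x|)`, and the bank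
integral is at most one. What remains is the sum of the shares of the total wealth held in the bank
and in the assets. -/
theorem lintegral_growthDefect_le (κ : ProbabilityMeasure (Fin N → ℝ≥0))
    (hζ : bankIntegral ρ κ (∑ k, y k) ζ ≤ 1) (hl : (l i).1 = hatProportion (ζ * ρ) κ) :
    ∫⁻ x, (growthDefect ρ x l y i ζ : ℝ≥0∞) ∂(κ : Measure (Fin N → ℝ≥0)) ≤ 1 := by
  set C : ℝ≥0 := ∑ k, y k with hC
  have hsum : bankTotal l y + ∑ n, assetTotal l y n = C := bankTotal_add_sum_assetTotal l y
  rcases eq_or_ne C 0 with h0 | h0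
  · have h0' : bankTotal l y = 0 ∧ ∑ n, assetTotal l y n = 0 := by
      rw [h0] at hsum
      exact add_eq_zero.1 hsum
    have h1 : ∀ n, assetTotal l y n = 0 := fun n =>
      Finset.sum_eq_zero_iff.1 h0'.2 n (Finset.mem_univ n)
    simp [growthDefect, h0'.1, h1]
  · have hpt : ∀ x : Fin N → ℝ≥0, (growthDefect ρ x l y i ζ : ℝ≥0∞)
        ≤ ((bankTotal l y / C : ℝ≥0) : ℝ≥0∞) * (((C * ρ : ℝ≥0) : ℝ≥0∞)
            / ((ζ * ρ + ∑ n, x n : ℝ≥0) : ℝ≥0∞))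
          + ∑ n, ((assetTotal l y n / ((l i).1 n * C) : ℝ≥0) : ℝ≥0∞)
            * ((x n : ℝ≥0∞) / ((ζ * ρ + ∑ n, x n : ℝ≥0) : ℝ≥0∞)) := by
      intro x
      rcases eq_or_ne (ζ * ρ + ∑ n, x n) 0 with hw | hw
      · simp [growthDefect, hw]
      · rw [← ENNReal.coe_div hw]
        simp_rw [← ENNReal.coe_div hw]
        norm_cast
        refine le_of_eq ?_
        rw [growthDefect, add_div, Finset.sum_div]
        congr 1
        · field_simp
        · exact Finset.sum_congr rfl fun n _ => by ring
    calc _ ≤ _ := lintegral_mono hpt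
      _ = ((bankTotal l y / C : ℝ≥0) : ℝ≥0∞) * bankIntegral ρ κ C ζ
          + ∑ n, ((assetTotal l y n / ((l i).1 n * C) : ℝ≥0) : ℝ≥0∞) * ((l i).1 n : ℝ≥0) := by
        rw [lintegral_add_left (by fun_prop), lintegral_const_mul _ (by fun_prop),
          lintegral_finsetSum _ (by fun_prop), hl]
        congr 1
        refine Finset.sum_congr rfl fun n _ => ?_
        rw [lintegral_const_mul _ (by fun_prop), coe_hatProportion]
      _ ≤ ((bankTotal l y / C : ℝ≥0) : ℝ≥0∞) * 1
          + ∑ n, ((assetTotal l y n / C : ℝ≥0) : ℝ≥0∞) := by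
        gcongr with n
        rw [← ENNReal.coe_mul, ENNReal.coe_le_coe]
        -- For a zero proportion the weight is zero by division by zero, so the term is only bounded
        -- by `p_n / C`.
        rcases eq_or_ne ((l i).1 n) 0 with h1 | h1
        · simp [h1]
        · refine le_of_eq ?_
          field_simp
      _ = 1 := by
        norm_cast
        rw [mul_one, ← Finset.sum_div, ← add_div, hsum, div_self h0]

end OneStep

theorem Measurable.growthDefect {T : Type*} [MeasurableSpace T] {M N : ℕ} {ρ ζ : T → ℝ≥0}
    {x : T → Fin N → ℝ≥0} {l : T → JointProportions M N} {y : T → Fin M → ℝ≥0} (i : Fin M)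
    (hρ : Measurable ρ) (hx : Measurable x) (hl : Measurable l) (hy : Measurable y)
    (hζ : Measurable ζ) :
    Measurable fun τ => _root_.growthDefect (ρ τ) (x τ) (l τ) (y τ) i (ζ τ) := by
  have hl' : ∀ m n, Measurable fun τ => (l τ m).1 n := fun m n =>
    (measurable_pi_apply n).comp (measurable_subtype_coe.comp ((measurable_pi_apply m).comp hl))
  have hy' : ∀ m, Measurable fun τ => y τ m := fun m => (measurable_pi_apply m).comp hy
  have hx' : ∀ n, Measurable fun τ => x τ n := fun n => (measurable_pi_apply n).comp hx
  unfold _root_.growthDefect bankTotal assetTotal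
  fun_prop

/-! ### The strategy `Λ̂` is relative growth optimal -/

namespace Market

variable {Ω : Type*} [mΩ : MeasurableSpace Ω] {P : Measure Ω} {F : Filtration ℕ mΩ} {M N : ℕ}
  {S : Market P F N} {K : ℕ → Ω → ProbabilityMeasure (Fin N → ℝ≥0)}

/-- The value `ζ_{t+1}(C_t)` realized when the investors use the profile `L`. -/
noncomputable def realizedZeta (S : Market P F N)
    (K : ℕ → Ω → ProbabilityMeasure (Fin N → ℝ≥0)) (L : Fin M → Rule Ω M N)
    (y₀ : Fin M → ℝ≥0) (t : ℕ) (ω : Ω) : ℝ≥0 :=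
  zeta (S.ρ (t + 1) ω) (K (t + 1) ω) (∑ k, S.wealth L y₀ t k ω)

theorem measurable_realizedZeta (hK : S.IsRegularConditionalLaw K) {L : Fin M → Rule Ω M N}
    (hL : ∀ m, IsStrategy F (L m)) (y₀ : Fin M → ℝ≥0) (t : ℕ) :
    Measurable[F t] (S.realizedZeta K L y₀ t) :=
  @Measurable.zeta _ (F t) _ _ (hK.measurable t) _ _ (S.predictable_ρ t)
    (Finset.measurable_sum _ fun k _ => S.measurable_wealth_apply hL y₀ t k)

theorem realizedProportions_hatRule {L : Fin M → Rule Ω M N} {i : Fin M}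
    (hi : L i = S.hatRule K) (y₀ : Fin M → ℝ≥0) (t : ℕ) (ω : Ω) :
    (realizedProportions L y₀ t ω i).1
      = hatProportion (S.realizedZeta K L y₀ t ω * S.ρ (t + 1) ω) (K (t + 1) ω) := by
  simp only [realizedProportions, hi]
  rfl

/-- The bank return and the payoffs cannot both fail to contribute to the wealth of an investor
using `Λ̂`. -/
theorem ae_pos_realizedZeta_mul_add [IsProbabilityMeasure P]
    (hK : S.IsRegularConditionalLaw K) {L : Fin M → Rule Ω M N}
    (hL : ∀ m, IsStrategy F (L m)) (y₀ : Fin M → ℝ≥0) (t : ℕ) :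
    ∀ᵐ ω ∂P, 0 < ∑ k, S.wealth L y₀ t k ω →
      0 < S.realizedZeta K L y₀ t ω * S.ρ (t + 1) ω + ∑ n, S.X (t + 1) ω n := by
  let mT : MeasurableSpace (Ω × (Fin N → ℝ≥0)) := (F t).prod inferInstance
  have hfst : Measurable[mT, F t] Prod.fst := @measurable_fst _ _ (F t) _
  have hsnd : Measurable[mT] Prod.snd := @measurable_snd _ _ (F t) _
  let f : Ω × (Fin N → ℝ≥0) → ℝ≥0∞ := fun p =>
    (((∑ k, S.wealth L y₀ t k p.1) * S.ρ (t + 1) p.1 : ℝ≥0) : ℝ≥0∞)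
      / ((S.realizedZeta K L y₀ t p.1 * S.ρ (t + 1) p.1 + ∑ n, p.2 n : ℝ≥0) : ℝ≥0∞)
  have hρ : Measurable[mT] fun p => S.ρ (t + 1) p.1 := (S.predictable_ρ t).comp hfst
  have hz : Measurable[mT] fun p => S.realizedZeta K L y₀ t p.1 :=
    (measurable_realizedZeta hK hL y₀ t).comp hfst
  have hw : ∀ k, Measurable[mT] fun p => S.wealth L y₀ t k p.1 := fun k =>
    (S.measurable_wealth_apply hL y₀ t k).comp hfst
  have hx : ∀ n, Measurable[mT] fun p => p.2 n := fun n => (measurable_pi_apply n).comp hsnd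
  have hf : Measurable[mT] f := by fun_prop
  have hfX : Measurable fun ω => f (ω, S.X (t + 1) ω) :=
    hf.comp (@Measurable.prodMk _ mΩ _ _ (F t) _ id _ (measurable_id'' (F.le t))
      ((S.adapted_X t).mono (F.le _) le_rfl))
  -- Hence `f` is finite almost surely, whereas a zero denominator with positive numerator would
  -- make it infinite.
  have hint : ∫⁻ ω, f (ω, S.X (t + 1) ω) ∂P ≤ 1 := by
    rw [hK.lintegral_eq t hf]
    refine (lintegral_mono (g := fun _ => 1) fun ω => ?_).trans (by simp)
    exact bankIntegral_zeta_le (S.ρ (t + 1) ω) (K (t + 1) ω) (∑ k, S.wealth L y₀ t k ω)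
  filter_upwards [ae_lt_top hfX (ne_top_of_le_ne_top ENNReal.one_ne_top hint), S.pos t]
    with ω hω hpos hC
  refine pos_of_ne_zero fun h0 => ?_
  have hX0 : ∑ n, S.X (t + 1) ω n = 0 := (add_eq_zero.1 h0).2
  rw [hX0, add_zero] at hpos
  simp only [f, h0, ENNReal.coe_zero] at hω
  rw [ENNReal.div_zero (ENNReal.coe_ne_zero.2 (mul_pos hC hpos).ne')] at hω
  exact lt_irrefl _ hω

/-- An investor using `Λ̂` invests in every asset with a nonzero payoff. -/
theorem ae_eq_zero_of_realizedProportions_eq_zero [IsProbabilityMeasure P]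
    (hK : S.IsRegularConditionalLaw K)
    {L : Fin M → Rule Ω M N} (hL : ∀ m, IsStrategy F (L m)) {i : Fin M}
    (hi : L i = S.hatRule K) (y₀ : Fin M → ℝ≥0) (t : ℕ) :
    ∀ᵐ ω ∂P, ∀ n, (realizedProportions L y₀ t ω i).1 n = 0 → S.X (t + 1) ω n = 0 := by
  rw [ae_all_iff]
  intro n
  let mT : MeasurableSpace (Ω × (Fin N → ℝ≥0)) := (F t).prod inferInstance
  have hfst : Measurable[mT, F t] Prod.fst := @measurable_fst _ _ (F t) _
  have hsnd : Measurable[mT] Prod.snd := @measurable_snd _ _ (F t) _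
  have hlm : Measurable[F t] fun ω => (realizedProportions L y₀ t ω i).1 n :=
    (measurable_pi_apply n).comp (measurable_subtype_coe.comp ((measurable_pi_apply i).comp
      (measurable_realizedProportions hL y₀ t)))
  let A : Set Ω := {ω | (realizedProportions L y₀ t ω i).1 n = 0}
  have hA : MeasurableSet[F t] A := hlm (measurableSet_singleton 0)
  let f : Ω × (Fin N → ℝ≥0) → ℝ≥0∞ := fun p => A.indicator 1 p.1 *
    ((p.2 n : ℝ≥0∞)
      / ((S.realizedZeta K L y₀ t p.1 * S.ρ (t + 1) p.1 + ∑ n, p.2 n : ℝ≥0) : ℝ≥0∞))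
  have hρ : Measurable[mT] fun p => S.ρ (t + 1) p.1 := (S.predictable_ρ t).comp hfst
  have hz : Measurable[mT] fun p => S.realizedZeta K L y₀ t p.1 :=
    (measurable_realizedZeta hK hL y₀ t).comp hfst
  have hx : ∀ n, Measurable[mT] fun p => p.2 n := fun n => (measurable_pi_apply n).comp hsnd
  have hAm : Measurable[mT] fun p => A.indicator (1 : Ω → ℝ≥0∞) p.1 :=
    (@Measurable.indicator _ _ A _ (F t) _ _ (@measurable_one _ _ _ (F t) _) hA).comp hfst
  have hf : Measurable[mT] f := by fun_prop
  have hfX : Measurable fun ω => f (ω, S.X (t + 1) ω) :=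
    hf.comp (@Measurable.prodMk _ mΩ _ _ (F t) _ id _ (measurable_id'' (F.le t))
      ((S.adapted_X t).mono (F.le _) le_rfl))
  -- Under `K` the quotient integrates to the proportion in asset `n`, which vanishes on `A`.
  have hint : ∫⁻ ω, f (ω, S.X (t + 1) ω) ∂P = 0 := by
    rw [hK.lintegral_eq t hf]
    refine (lintegral_congr fun ω => ?_).trans lintegral_zero
    simp only [f]
    rw [lintegral_const_mul _ (by fun_prop), ← coe_hatProportion,
      ← realizedProportions_hatRule hi]
    by_cases hω : ω ∈ A
    · rw [show (realizedProportions L y₀ t ω i).1 n = 0 from hω]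
      simp
    · simp [hω]
  filter_upwards [(lintegral_eq_zero_iff hfX).1 hint] with ω hω h0
  have hωA : ω ∈ A := h0
  simp only [f, hωA, Set.indicator_of_mem, Pi.one_apply, one_mul, Pi.zero_apply,
    ENNReal.div_eq_zero_iff, ENNReal.coe_ne_top, or_false, ENNReal.coe_eq_zero] at hω
  exact hω

/-- The conditional mean of the defect is at most one, tested on sets of `F t`. -/
theorem setLIntegral_growthDefect_le [IsProbabilityMeasure P]
    (hK : S.IsRegularConditionalLaw K)
    {L : Fin M → Rule Ω M N} (hL : ∀ m, IsStrategy F (L m)) {i : Fin M}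
    (hi : L i = S.hatRule K) (y₀ : Fin M → ℝ≥0) (t : ℕ) {A : Set Ω} (hA : MeasurableSet[F t] A) :
    ∫⁻ ω in A, (growthDefect (S.ρ (t + 1) ω) (S.X (t + 1) ω) (realizedProportions L y₀ t ω)
      (fun k => S.wealth L y₀ t k ω) i (S.realizedZeta K L y₀ t ω) : ℝ≥0∞) ∂P ≤ P A := by
  let mT : MeasurableSpace (Ω × (Fin N → ℝ≥0)) := (F t).prod inferInstance
  have hfst : Measurable[mT, F t] Prod.fst := @measurable_fst _ _ (F t) _
  have hsnd : Measurable[mT] Prod.snd := @measurable_snd _ _ (F t) _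
  have hU : Measurable[mT] fun p => growthDefect (S.ρ (t + 1) p.1) p.2
      (realizedProportions L y₀ t p.1) (fun k => S.wealth L y₀ t k p.1) i
      (S.realizedZeta K L y₀ t p.1) :=
    Measurable.growthDefect i ((S.predictable_ρ t).comp hfst) hsnd
      ((measurable_realizedProportions hL y₀ t).comp hfst)
      ((S.measurable_wealth hL y₀ t).comp hfst)
      ((measurable_realizedZeta hK hL y₀ t).comp hfst)
  let f : Ω × (Fin N → ℝ≥0) → ℝ≥0∞ := fun p => A.indicator 1 p.1 *
    (growthDefect (S.ρ (t + 1) p.1) p.2 (realizedProportions L y₀ t p.1)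
      (fun k => S.wealth L y₀ t k p.1) i (S.realizedZeta K L y₀ t p.1) : ℝ≥0∞)
  have hAm : Measurable[mT] fun p => A.indicator (1 : Ω → ℝ≥0∞) p.1 :=
    (@Measurable.indicator _ _ A _ (F t) _ _ (@measurable_one _ _ _ (F t) _) hA).comp hfst
  have hf : Measurable[mT] f := hAm.mul hU.coe_nnreal_ennreal
  have hA' : MeasurableSet A := F.le t A hA
  calc _ = ∫⁻ ω, f (ω, S.X (t + 1) ω) ∂P := by
        rw [← lintegral_indicator hA']
        refine lintegral_congr fun ω => ?_
        by_cases hω : ω ∈ A <;> simp [f, hω]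
    _ = ∫⁻ ω, ∫⁻ x, f (ω, x) ∂(K (t + 1) ω : Measure (Fin N → ℝ≥0)) ∂P := hK.lintegral_eq t hf
    _ ≤ ∫⁻ ω, A.indicator 1 ω ∂P := by
        refine lintegral_mono fun ω => ?_
        by_cases hω : ω ∈ A
        · simp only [f, hω, Set.indicator_of_mem, Pi.one_apply, one_mul]
          exact lintegral_growthDefect_le _ _ _ _ _ _ (bankIntegral_zeta_le _ _ _)
            (realizedProportions_hatRule hi y₀ t ω)
        · simp [f, hω]
    _ = P A := lintegral_indicator_one hA'

/-- The main property of `Λ̂`: the logarithm of the relative wealth is a submartingale. -/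
theorem submartingale_log_relWealth_hatRule [IsProbabilityMeasure P]
    (hK : S.IsRegularConditionalLaw K)
    {L : Fin M → Rule Ω M N} (hL : ∀ m, IsStrategy F (L m)) {i : Fin M}
    (hi : L i = S.hatRule K) {y₀ : Fin M → ℝ≥0} (hy₀ : ∀ m, 0 < y₀ m) :
    (∀ t, ∀ᵐ ω ∂P, 0 < S.relWealth L y₀ t i ω) ∧
      Submartingale (fun t ω => Real.log (S.relWealth L y₀ t i ω)) F P := by
  let U : ℕ → Ω → ℝ≥0 := fun t ω => growthDefect (S.ρ (t + 1) ω) (S.X (t + 1) ω)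
    (realizedProportions L y₀ t ω) (fun k => S.wealth L y₀ t k ω) i (S.realizedZeta K L y₀ t ω)
  have hUm : ∀ t, Measurable (U t) := fun t =>
    Measurable.growthDefect i ((S.predictable_ρ t).mono (F.le _) le_rfl)
      ((S.adapted_X t).mono (F.le _) le_rfl)
      ((measurable_realizedProportions hL y₀ t).mono (F.le _) le_rfl)
      ((S.measurable_wealth hL y₀ t).mono (F.le _) le_rfl)
      ((measurable_realizedZeta hK hL y₀ t).mono (F.le _) le_rfl)
  have hUint : ∀ t, Integrable (fun ω => (U t ω : ℝ)) P := by
    intro t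
    refine ⟨(hUm t).coe_nnreal_real.aestronglyMeasurable, ?_⟩
    have := setLIntegral_growthDefect_le hK hL hi y₀ t (@MeasurableSet.univ _ (F t))
    rw [Measure.restrict_univ, measure_univ] at this
    refine lt_of_le_of_lt ?_ (this.trans_lt ENNReal.one_lt_top)
    exact (lintegral_congr fun ω => by simp [U]).le
  have hUset : ∀ t A, MeasurableSet[F t] A → ∫ ω in A, (1 - (U t ω : ℝ)) ∂P ≥ 0 := by
    intro t A hA
    rw [integral_sub (integrable_const _) (hUint t).integrableOn, ge_iff_le, sub_nonneg]
    have h1 : ∫ ω in A, (U t ω : ℝ) ∂P = (∫⁻ ω in A, (U t ω : ℝ≥0∞) ∂P).toReal :=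
      integral_toReal (hUm t).coe_nnreal_ennreal.aemeasurable (by simp)
    rw [h1]
    simpa [Measure.real] using ENNReal.toReal_mono (measure_ne_top P A)
      (setLIntegral_growthDefect_le hK hL hi y₀ t hA)
  have hstep : ∀ t, ∀ᵐ ω ∂P, 0 < S.wealth L y₀ t i ω →
      0 < S.wealth L y₀ (t + 1) i ω ∧ 1 - (U t ω : ℝ)
        ≤ Real.log (S.relWealth L y₀ (t + 1) i ω) - Real.log (S.relWealth L y₀ t i ω) := by
    intro t
    filter_upwards [ae_pos_realizedZeta_mul_add hK hL y₀ t,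
      ae_eq_zero_of_realizedProportions_eq_zero hK hL hi y₀ t] with ω h1 h2 hpos
    have hC : 0 < ∑ k, S.wealth L y₀ t k ω := hpos.trans_le
      (Finset.single_le_sum (f := fun k => S.wealth L y₀ t k ω) (fun _ _ => zero_le)
        (Finset.mem_univ i))
    have := one_sub_growthDefect_le (S.ρ (t + 1) ω) (S.X (t + 1) ω)
      (realizedProportions L y₀ t ω) (fun k => S.wealth L y₀ t k ω) i
      (S.realizedZeta K L y₀ t ω) hpos (h1 hC) ?_ h2
    · simpa only [relWealth, wealth_succ] using this
    · rw [realizedProportions_hatRule hi]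
      exact zeta_add_mul_sum_hatProportion_le _ _ _
  have hpos : ∀ t, ∀ᵐ ω ∂P, 0 < S.wealth L y₀ t i ω := by
    intro t
    induction t with
    | zero => exact ae_of_all _ fun ω => hy₀ i
    | succ t ih =>
      filter_upwards [ih, hstep t] with ω h1 h2 using (h2 h1).1
  have hinc : ∀ t, ∀ᵐ ω ∂P, Real.log (S.relWealth L y₀ t i ω) + (1 - (U t ω : ℝ))
      ≤ Real.log (S.relWealth L y₀ (t + 1) i ω) := by
    intro t
    filter_upwards [hpos t, hstep t] with ω h1 h2
    linarith [(h2 h1).2]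
  have hmeas : ∀ t, Measurable[F t] fun ω => Real.log (S.relWealth L y₀ t i ω) := fun t =>
    Real.measurable_log.comp (measurable_coe_nnreal_real.comp (S.measurable_relWealth hL y₀ t i))
  have hnonpos : ∀ t ω, Real.log (S.relWealth L y₀ t i ω) ≤ 0 := fun t ω =>
    Real.log_nonpos (NNReal.coe_nonneg _) (by exact_mod_cast S.relWealth_le_one L y₀ t i ω)
  -- By induction: the new logarithm lies between the integrable previous logarithm plus `1 - U` and
  -- zero.
  have hint : ∀ t, Integrable (fun ω => Real.log (S.relWealth L y₀ t i ω)) P := by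
    intro t
    induction t with
    | zero =>
      have : (fun ω => Real.log (S.relWealth L y₀ 0 i ω))
          = fun _ => Real.log ((y₀ i / ∑ k, y₀ k : ℝ≥0) : ℝ) := rfl
      rw [this]
      exact integrable_const _
    | succ t ih =>
      have h1 : Integrable (fun ω => Real.log (S.relWealth L y₀ t i ω) + (1 - (U t ω : ℝ))) P :=
        ih.add ((integrable_const _).sub (hUint t))
      refine h1.mono ((hmeas (t + 1)).mono (F.le _) le_rfl).aestronglyMeasurable ?_
      filter_upwards [hinc t] with ω hω
      rw [Real.norm_eq_abs, Real.norm_eq_abs, abs_of_nonpos (hnonpos _ _),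
        abs_of_nonpos (hω.trans (hnonpos _ _))]
      linarith
  refine ⟨fun t => ?_, submartingale_of_setIntegral_le_succ
    (fun t => (hmeas t).stronglyMeasurable) hint fun t A hA => ?_⟩
  · filter_upwards [hpos t] with ω hω
    exact div_pos hω (hω.trans_le (Finset.single_le_sum (f := fun k => S.wealth L y₀ t k ω)
      (fun _ _ => zero_le) (Finset.mem_univ i)))
  · have hi1 : Integrable (fun ω => 1 - (U t ω : ℝ)) P := (integrable_const _).sub (hUint t)
    calc ∫ ω in A, Real.log (S.relWealth L y₀ t i ω) ∂P
        ≤ ∫ ω in A, Real.log (S.relWealth L y₀ t i ω) ∂P + ∫ ω in A, (1 - (U t ω : ℝ)) ∂P :=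
          le_add_of_nonneg_right (hUset t A hA)
      _ = ∫ ω in A, (Real.log (S.relWealth L y₀ t i ω) + (1 - (U t ω : ℝ))) ∂P :=
          (integral_add (hint t).integrableOn hi1.integrableOn).symm
      _ ≤ ∫ ω in A, Real.log (S.relWealth L y₀ (t + 1) i ω) ∂P :=
          setIntegral_mono_ae ((hint t).add hi1).integrableOn (hint (t + 1)).integrableOn
            (hinc t)

end Market

/-! ### Comparison of generalized conditional expectations -/

/-- The measures with densities `f` and `condLExp m P f` agree on `m`, hence integrate `g` equally;
no integrability is needed. -/
theorem lintegral_mul_eq_lintegral_mul_condLExp {Ω : Type*} {m mΩ : MeasurableSpace Ω}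
    (hm : m ≤ mΩ) (P : Measure Ω) [IsFiniteMeasure P] {f g : Ω → ℝ≥0∞} (hf : Measurable f)
    (hg : Measurable[m] g) :
    ∫⁻ ω, g ω * f ω ∂P = ∫⁻ ω, g ω * condLExp m P f ω ∂P := by
  have hg' : Measurable g := hg.mono hm le_rfl
  have htrim : (P.withDensity f).trim hm = (P.withDensity (condLExp m P f)).trim hm := by
    refine @Measure.ext _ m _ _ fun A hA => ?_
    rw [trim_measurableSet_eq hm hA, trim_measurableSet_eq hm hA, withDensity_apply _ (hm A hA),
      withDensity_apply _ (hm A hA), setLIntegral_condLExp hm P f hA]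
  calc ∫⁻ ω, g ω * f ω ∂P = ∫⁻ ω, g ω ∂(P.withDensity f) := by
        rw [lintegral_withDensity_eq_lintegral_mul _ hf hg']
        simp [mul_comm]
    _ = ∫⁻ ω, g ω ∂(P.withDensity (condLExp m P f)) := by
        rw [← lintegral_trim hm hg, htrim, lintegral_trim hm hg]
    _ = _ := by
        rw [lintegral_withDensity_eq_lintegral_mul _ (measurable_condLExp' m P f) hg']
        simp [mul_comm]

/-- Pull-out property of the conditional Lebesgue expectation. -/
theorem condLExp_mul_of_measurable_left {Ω : Type*} {m mΩ : MeasurableSpace Ω}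
    (hm : m ≤ mΩ) (P : Measure Ω) [IsFiniteMeasure P] {f g : Ω → ℝ≥0∞} (hf : Measurable f)
    (hg : Measurable[m] g) :
    condLExp m P (fun ω => g ω * f ω) =ᵐ[P] fun ω => g ω * condLExp m P f ω := by
  refine (ae_eq_condLExp hm P _ (hg.mul (measurable_condLExp m P f)) fun A hA => ?_).symm
  have hgA : Measurable[m] (A.indicator g) := Measurable.indicator hg hA
  have := lintegral_mul_eq_lintegral_mul_condLExp hm P hf hgA
  rw [← lintegral_indicator (hm A hA), ← lintegral_indicator (hm A hA)]
  refine Eq.trans (lintegral_congr fun ω => ?_) (this.symm.trans (lintegral_congr fun ω => ?_))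
  · exact Set.indicator_mul_left A g _
  · exact (Set.indicator_mul_left A g f).symm

theorem condLExp_ofReal_neg_le {Ω : Type*} {m mΩ : MeasurableSpace Ω} {P : Measure Ω}
    {w : Ω → ℝ} (hw : Integrable w P) (h0 : 0 ≤ᵐ[P] P[w | m]) :
    ∀ᵐ ω ∂P, condLExp m P (fun ω => ENNReal.ofReal (-w ω)) ω
      ≤ condLExp m P (fun ω => ENNReal.ofReal (w ω)) ω ∧
        condLExp m P (fun ω => ENNReal.ofReal (w ω)) ω < ∞ := by
  have hfin : ∀ {v : Ω → ℝ}, Integrable v P → ∫⁻ ω, ENNReal.ofReal (v ω) ∂P ≠ ∞ :=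
    fun hv => hv.lintegral_lt_top.ne
  have hpm : ∀ {v : Ω → ℝ}, Integrable v P →
      Integrable (fun ω => (ENNReal.ofReal (v ω)).toReal) P := fun hv => by
    simpa [ENNReal.toReal_ofReal'] using hv.pos_part
  have hsub : (fun ω => (ENNReal.ofReal (w ω)).toReal) - (fun ω => (ENNReal.ofReal (-w ω)).toReal)
      = w := by
    ext ω
    simp only [Pi.sub_apply, ENNReal.toReal_ofReal']
    exact max_zero_sub_max_neg_zero_eq_self (w ω)
  have hE := condExp_sub (hpm hw) (hpm hw.neg) m
  rw [show (fun ω => (ENNReal.ofReal ((-w) ω)).toReal)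
    = fun ω => (ENNReal.ofReal (-w ω)).toReal from rfl, hsub] at hE
  filter_upwards [hE, h0, toReal_condLExp m hw.1.aemeasurable.ennreal_ofReal (hfin hw),
    toReal_condLExp m hw.neg.1.aemeasurable.ennreal_ofReal (hfin hw.neg),
    condLExp_lt_top (mΩ := m) (hfin hw), condLExp_lt_top (mΩ := m) (hfin hw.neg)]
    with ω h1 h2 h3 h4 h5 h6
  refine ⟨?_, h5⟩
  simp only [Pi.zero_apply, Pi.sub_apply, Pi.neg_apply] at h1 h2 h3 h4 h6
  rw [← ENNReal.toReal_le_toReal h6.ne h5.ne, h3, h4]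
  linarith

/-- Meant for conditional means of positive and negative parts: `a, a'` of `f`, `b, b'` of `g` and
`v, v'` of `c w`. Only the last pair is known to be finite; `h'` keeps `b'` finite whenever `a'` is.
-/
theorem ereal_sub_le_sub_of_add_le {a a' b b' v v' : ℝ≥0∞} (hv : v' ≤ v) (hv_top : v < ∞)
    (h : a + v + b' ≤ b + a' + v') (h' : b' ≤ a' + v') :
    (a : EReal) - (a' : EReal) ≤ (b : EReal) - (b' : EReal) := by
  have hv' : v' ≠ ∞ := (hv.trans_lt hv_top).ne
  have h1 : a + b' ≤ b + a' := by
    refine (ENNReal.add_le_add_iff_right hv').1 (le_trans ?_ h)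
    calc a + b' + v' ≤ a + b' + v := by gcongr
      _ = a + v + b' := by ring
  -- Here the left side is `⊥`, whatever `a` is.
  rcases eq_or_ne a' ∞ with rfl | ha'
  · simp
  have hb' : b' ≠ ∞ := ne_top_of_le_ne_top (ENNReal.add_ne_top.2 ⟨ha', hv'⟩) h'
  rcases eq_or_ne b ∞ with rfl | hb
  · lift b' to ℝ≥0 using hb'
    have : ((∞ : ℝ≥0∞) : EReal) - ((b' : ℝ≥0∞) : EReal) = ⊤ := EReal.top_sub_coe (b' : ℝ)
    rw [this]
    exact le_top
  have ha : a ≠ ∞ := ne_top_of_le_ne_top (ENNReal.add_ne_top.2 ⟨hb, ha'⟩) (le_self_add.trans h1)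
  lift a to ℝ≥0 using ha
  lift a' to ℝ≥0 using ha'
  lift b to ℝ≥0 using hb
  lift b' to ℝ≥0 using hb'
  have h2 : (a : ℝ) + b' ≤ b + a' := by exact_mod_cast h1
  change (((a : ℝ) - (a' : ℝ) : ℝ) : EReal) ≤ (((b : ℝ) - (b' : ℝ) : ℝ) : EReal)
  exact EReal.coe_le_coe_iff.2 (by linarith)

/-- The inequality `f + v ≤ g` rewritten without subtraction, so that it survives conditioning of
the six parts one by one. -/
theorem toENNReal_add_ofReal_add_le {f : EReal} {g v : ℝ} (h : f + (v : EReal) ≤ (g : EReal)) :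
    f.toENNReal + ENNReal.ofReal v + (-(g : EReal)).toENNReal
      ≤ (g : EReal).toENNReal + (-f).toENNReal + ENNReal.ofReal (-v) ∧
    (-(g : EReal)).toENNReal ≤ (-f).toENNReal + ENNReal.ofReal (-v) := by
  induction f with
  | bot => simp
  | top => simp at h
  | coe f =>
    have h' : f + v ≤ g := by exact_mod_cast h
    rw [← EReal.coe_neg, ← EReal.coe_neg]
    simp only [EReal.real_coe_toENNReal]
    constructor
    · rw [← ENNReal.toReal_le_toReal (by finiteness) (by finiteness)]
      repeat rw [ENNReal.toReal_add (by finiteness) (by finiteness)]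
      simp only [ENNReal.toReal_ofReal']
      have := max_zero_sub_max_neg_zero_eq_self f
      have := max_zero_sub_max_neg_zero_eq_self g
      have := max_zero_sub_max_neg_zero_eq_self v
      linarith
    · calc ENNReal.ofReal (-g) ≤ ENNReal.ofReal (-f + -v) :=
            ENNReal.ofReal_le_ofReal (by linarith)
        _ ≤ _ := ENNReal.ofReal_add_le

/-- Comparison of generalized conditional expectations of `f ≤ g - c w`, where `c ≥ 0` is
measurable with respect to the conditioning σ-algebra and `w` has nonnegative conditional mean. -/
theorem extCondExp_le_of_add_mul_le {Ω : Type*} {m : MeasurableSpace Ω}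
    [mΩ : MeasurableSpace Ω] {P : Measure Ω} [IsFiniteMeasure P] (hm : m ≤ mΩ)
    {f g : Ω → EReal} {c : Ω → ℝ≥0}
    {w : Ω → ℝ} (hf : Measurable f) (hg : Measurable g) (hc : Measurable[m] c)
    (hwm : Measurable w) (hw : Integrable w P) (h0 : 0 ≤ᵐ[P] P[w | m])
    (hg_real : ∀ᵐ ω ∂P, g ω ≠ ⊤ ∧ g ω ≠ ⊥)
    (hfg : ∀ᵐ ω ∂P, f ω + (((c ω : ℝ) * w ω : ℝ) : EReal) ≤ g ω) :
    ∀ᵐ ω ∂P, extCondExp P m f ω ≤ extCondExp P m g ω := by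
  have hcw : ∀ {v : Ω → ℝ} (ω : Ω), ENNReal.ofReal ((c ω : ℝ) * v ω)
      = (c ω : ℝ≥0∞) * ENNReal.ofReal (v ω) := fun ω => by
    rw [ENNReal.ofReal_mul (NNReal.coe_nonneg _), ENNReal.ofReal_coe_nnreal]
  have hcE : Measurable[m] fun ω => (c ω : ℝ≥0∞) := measurable_coe_nnreal_ennreal.comp hc
  have hcE' : Measurable fun ω => (c ω : ℝ≥0∞) := hcE.mono hm le_rfl
  let fp : Ω → ℝ≥0∞ := fun ω => (f ω).toENNReal
  let fm : Ω → ℝ≥0∞ := fun ω => (-f ω).toENNReal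
  let gp : Ω → ℝ≥0∞ := fun ω => (g ω).toENNReal
  let gm : Ω → ℝ≥0∞ := fun ω => (-g ω).toENNReal
  let vp : Ω → ℝ≥0∞ := fun ω => (c ω : ℝ≥0∞) * ENNReal.ofReal (w ω)
  let vm : Ω → ℝ≥0∞ := fun ω => (c ω : ℝ≥0∞) * ENNReal.ofReal (-w ω)
  have hfp : Measurable fp := hf.ereal_toENNReal
  have hfm : Measurable fm := hf.neg.ereal_toENNReal
  have hgp : Measurable gp := hg.ereal_toENNReal
  have hvp : Measurable vp := hcE'.mul hwm.ennreal_ofReal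
  have hvm : Measurable vm := hcE'.mul hwm.neg.ennreal_ofReal
  -- All terms are in `[0, ∞]`, since `c w` need not be integrable; finiteness of its conditional
  -- parts comes from pulling out `c`.
  have hpt : ∀ᵐ ω ∂P, (fp + vp + gm) ω ≤ (gp + fm + vm) ω ∧ gm ω ≤ (fm + vm) ω := by
    filter_upwards [hg_real, hfg] with ω h1 h2
    have hgω : g ω = ((g ω).toReal : EReal) := (EReal.coe_toReal h1.1 h1.2).symm
    rw [hgω] at h2
    have := toENNReal_add_ofReal_add_le h2
    rw [← mul_neg, hcw, hcw (v := fun ω => -w ω), ← hgω] at this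
    exact this
  filter_upwards [condLExp_mono (mΩ := m) (hpt.mono fun ω h => h.1),
    condLExp_mono (mΩ := m) (hpt.mono fun ω h => h.2),
    condLExp_add_left (mΩ := m) gm (hfp.add hvp).aemeasurable,
    condLExp_add_left (mΩ := m) vp hfp.aemeasurable,
    condLExp_add_left (mΩ := m) vm (hgp.add hfm).aemeasurable,
    condLExp_add_left (mΩ := m) fm hgp.aemeasurable,
    condLExp_add_left (mΩ := m) vm hfm.aemeasurable,
    condLExp_mul_of_measurable_left hm P hwm.ennreal_ofReal hcE,
    condLExp_mul_of_measurable_left hm P hwm.neg.ennreal_ofReal hcE,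
    condLExp_ofReal_neg_le hw h0] with ω h1 h2 e1 e2 e3 e4 e5 e6 e7 hW
  simp only [Pi.add_apply] at e1 e2 e3 e4 e5
  rw [e1, e2, e3, e4] at h1
  rw [e5] at h2
  refine ereal_sub_le_sub_of_add_le (v := condLExp m P vp ω) (v' := condLExp m P vm ω) ?_ ?_ h1 h2
  · rw [show condLExp m P vp ω = _ from e6, show condLExp m P vm ω = _ from e7]
    gcongr
    exact hW.1
  · rw [show condLExp m P vp ω = _ from e6]
    exact ENNReal.mul_lt_top ENNReal.coe_lt_top hW.2

/-! ### Growth rates -/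

/-- A submartingale bounded above by zero converges almost surely. -/
theorem MeasureTheory.Submartingale.exists_ae_tendsto_of_nonpos {Ω : Type*}
    [mΩ : MeasurableSpace Ω] {P : Measure Ω} [IsFiniteMeasure P] {F : Filtration ℕ mΩ}
    {f : ℕ → Ω → ℝ} (hf : Submartingale f F P) (h0 : ∀ t ω, f t ω ≤ 0) :
    ∀ᵐ ω ∂P, ∃ c, Tendsto (fun t => f t ω) atTop (nhds c) := by
  refine hf.exists_ae_tendsto_of_bdd (R := (-∫ ω, f 0 ω ∂P).toNNReal) fun t => ?_
  have h1 : ∫ ω, f 0 ω ∂P ≤ ∫ ω, f t ω ∂P := by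
    simpa using hf.setIntegral_le (Nat.zero_le t) (@MeasurableSet.univ _ (F 0))
  rw [eLpNorm_one_eq_lintegral_enorm, ← ofReal_integral_norm_eq_lintegral_enorm
    (hf.integrable t)]
  change _ ≤ ENNReal.ofReal _
  refine ENNReal.ofReal_le_ofReal ?_
  have h2 : ∫ ω, ‖f t ω‖ ∂P = -∫ ω, f t ω ∂P := by
    rw [← integral_neg]
    exact integral_congr_ae (ae_of_all _ fun ω => abs_of_nonpos (h0 t ω))
  linarith

/-- Exponential growth rates are monotone with respect to domination up to a constant. -/
theorem limsup_log_div_le {u v : ℕ → ℝ≥0} {b : ℝ≥0} (hb : b ≠ 0) (h : ∀ t, u t ≤ b * v t) :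
    limsup (fun t : ℕ => ENNReal.log (u t : ℝ≥0∞) / (t : EReal)) atTop
      ≤ limsup (fun t : ℕ => ENNReal.log (v t : ℝ≥0∞) / (t : EReal)) atTop := by
  have hlim : Tendsto (fun t : ℕ => ((Real.log b / t : ℝ) : EReal)) atTop (nhds 0) := by
    have := tendsto_const_div_atTop_nhds_zero_nat (Real.log b)
    exact_mod_cast (continuous_coe_real_ereal.tendsto 0).comp this
  have hpt : ∀ t : ℕ, ENNReal.log (u t : ℝ≥0∞) / (t : EReal)
      ≤ ((Real.log b / t : ℝ) : EReal) + ENNReal.log (v t : ℝ≥0∞) / (t : EReal) := by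
    intro t
    have h1 : ENNReal.log (u t : ℝ≥0∞) ≤ (Real.log b : EReal) + ENNReal.log (v t : ℝ≥0∞) := by
      rw [← ENNReal.log_of_nnreal hb, ← ENNReal.log_mul_add]
      exact ENNReal.log_le_log (by exact_mod_cast h t)
    have ht : (0 : EReal) ≤ (t : EReal) := by positivity
    refine (EReal.div_le_div_right_of_nonneg ht h1).trans (le_of_eq ?_)
    rw [EReal.add_div_of_nonneg_right ht, EReal.coe_div, EReal.coe_natCast]
  calc _ ≤ limsup (fun t : ℕ => ((Real.log b / t : ℝ) : EReal)
          + ENNReal.log (v t : ℝ≥0∞) / (t : EReal)) atTop :=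
        limsup_le_limsup (Eventually.of_forall hpt)
    _ ≤ limsup (fun t : ℕ => ((Real.log b / t : ℝ) : EReal)) atTop
        + limsup (fun t : ℕ => ENNReal.log (v t : ℝ≥0∞) / (t : EReal)) atTop :=
        -- The first limsup is zero, so no sum `⊥ + ⊤` arises.
        EReal.limsup_add_le (by simp [hlim.limsup_eq]) (by simp [hlim.limsup_eq])
    _ = _ := by rw [hlim.limsup_eq, zero_add]

/-! ### The positive part of the logarithm -/

/-- `ln⁺ x` with values in `[0, ∞]`. -/
noncomputable def logPos (x : ℝ≥0) : ℝ≥0∞ := (ENNReal.log (x : ℝ≥0∞)).toENNReal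

theorem measurable_logPos : Measurable logPos :=
  (measurable_coe_nnreal_ennreal.ennreal_log).ereal_toENNReal

theorem logPos_mono : Monotone logPos := fun _ _ h =>
  EReal.toENNReal_le_toENNReal (ENNReal.log_le_log (ENNReal.coe_le_coe.2 h))

theorem logPos_lt_top (x : ℝ≥0) : logPos x < ∞ := by
  rw [lt_top_iff_ne_top, logPos, EReal.toENNReal_ne_top_iff, Ne, ENNReal.log_eq_top_iff]
  exact ENNReal.coe_ne_top

theorem logPos_mul_le (x y : ℝ≥0) : logPos (x * y) ≤ logPos x + logPos y := by
  rw [logPos, ENNReal.coe_mul, ENNReal.log_mul_add]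
  exact EReal.toENNReal_add_le

theorem logPos_le_self (x : ℝ≥0) : logPos x ≤ x := by
  rcases eq_or_ne x 0 with rfl | hx
  · simp [logPos]
  · rw [logPos, ENNReal.log_of_nnreal hx, EReal.real_coe_toENNReal, ← ENNReal.ofReal_coe_nnreal]
    refine ENNReal.ofReal_le_ofReal ?_
    have := Real.log_le_sub_one_of_pos (NNReal.coe_pos.2 (pos_of_ne_zero hx))
    linarith

theorem logPos_add_le (x y : ℝ≥0) : logPos (x + y) ≤ logPos 2 + (logPos x + logPos y) := by
  rcases le_total x y with h | h
  · calc logPos (x + y) ≤ logPos (2 * y) := logPos_mono (by rw [two_mul]; gcongr)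
      _ ≤ logPos 2 + logPos y := logPos_mul_le _ _
      _ ≤ _ := by gcongr; exact le_add_self
  · calc logPos (x + y) ≤ logPos (2 * x) := logPos_mono (by rw [two_mul]; gcongr)
      _ ≤ logPos 2 + logPos x := logPos_mul_le _ _
      _ ≤ _ := by gcongr; exact le_self_add

namespace Market

variable {Ω : Type*} [mΩ : MeasurableSpace Ω] {P : Measure Ω} {F : Filtration ℕ mΩ} {M N : ℕ}

/-- Induction on `C_{t+1} ≤ ρ C_t + |X|`, which gives `ln⁺ C_{t+1} ≤ ln⁺ 2 + ln⁺ ρ + ln⁺ C_t + |X|`.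
-/
theorem lintegral_logPos_sum_wealth_lt_top [IsFiniteMeasure P] (S : Market P F N)
    {L : Fin M → Rule Ω M N} (hL : ∀ m, IsStrategy F (L m)) (y₀ : Fin M → ℝ≥0)
    (hX : ∀ t, Integrable (fun ω => ((∑ n, S.X (t + 1) ω n : ℝ≥0) : ℝ)) P)
    (hρ : ∀ t, ∫⁻ ω, logPos (S.ρ (t + 1) ω) ∂P < ∞) (t : ℕ) :
    ∫⁻ ω, logPos (∑ k, S.wealth L y₀ t k ω) ∂P < ∞ := by
  induction t with
  | zero =>
    simp only [wealth_zero, lintegral_const]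
    exact ENNReal.mul_lt_top (logPos_lt_top _) (measure_lt_top _ _)
  | succ t ih =>
    have hρm : Measurable fun ω => logPos (S.ρ (t + 1) ω) :=
      measurable_logPos.comp ((S.predictable_ρ t).mono (F.le _) le_rfl)
    have hCm : Measurable fun ω => logPos (∑ k, S.wealth L y₀ t k ω) :=
      measurable_logPos.comp (Finset.measurable_sum _ fun k _ =>
        (S.measurable_wealth_apply hL y₀ t k).mono (F.le _) le_rfl)
    have hXfin : ∫⁻ ω, ((∑ n, S.X (t + 1) ω n : ℝ≥0) : ℝ≥0∞) ∂P < ∞ := by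
      simpa only [ENNReal.ofReal_coe_nnreal] using (hX t).lintegral_lt_top
    calc ∫⁻ ω, logPos (∑ k, S.wealth L y₀ (t + 1) k ω) ∂P
        ≤ ∫⁻ ω, (logPos 2 + ((logPos (S.ρ (t + 1) ω) + logPos (∑ k, S.wealth L y₀ t k ω))
            + ((∑ n, S.X (t + 1) ω n : ℝ≥0) : ℝ≥0∞))) ∂P := by
          refine lintegral_mono fun ω => ?_
          simp only [wealth_succ]
          refine (logPos_mono (sum_wealthStep_le' _ _ _ _)).trans ((logPos_add_le _ _).trans ?_)
          gcongr
          · exact logPos_mul_le _ _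
          · exact logPos_le_self _
      _ = ∫⁻ _, logPos 2 ∂P + ((∫⁻ ω, logPos (S.ρ (t + 1) ω) ∂P
            + ∫⁻ ω, logPos (∑ k, S.wealth L y₀ t k ω) ∂P)
            + ∫⁻ ω, ((∑ n, S.X (t + 1) ω n : ℝ≥0) : ℝ≥0∞) ∂P) := by
          rw [lintegral_add_left measurable_const, lintegral_add_left (by fun_prop),
            lintegral_add_left hρm]
      _ < ∞ := by
          refine ENNReal.add_lt_top.2 ⟨?_, ENNReal.add_lt_top.2
            ⟨ENNReal.add_lt_top.2 ⟨hρ t, ih⟩, hXfin⟩⟩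
          rw [lintegral_const]
          exact ENNReal.mul_lt_top (logPos_lt_top _) (measure_lt_top _ _)

/-- The positive part is at most `ln⁺ C_{s+t} + ln⁺ (1 / Y_s^m)`. The first term is integrable; the
second need not be, but it is finite and known at time `s`. -/
theorem ae_condLExp_logReturn_lt_top [IsFiniteMeasure P] (S : Market P F N)
    {L : Fin M → Rule Ω M N} (hL : ∀ m, IsStrategy F (L m)) (y₀ : Fin M → ℝ≥0)
    (hX : ∀ t, Integrable (fun ω => ((∑ n, S.X (t + 1) ω n : ℝ≥0) : ℝ)) P)
    (hρ : ∀ t, ∫⁻ ω, logPos (S.ρ (t + 1) ω) ∂P < ∞) (m : Fin M) (s t : ℕ) :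
    ∀ᵐ ω ∂P, condLExp (F s) P (fun ω' => (S.logReturn L y₀ s t m ω').toENNReal) ω < ∞ := by
  let u : Ω → ℝ≥0∞ := fun ω => logPos (∑ k, S.wealth L y₀ (s + t) k ω)
  let v : Ω → ℝ≥0∞ := fun ω => logPos (S.wealth L y₀ s m ω)⁻¹
  have hu : Measurable u := measurable_logPos.comp (Finset.measurable_sum _ fun k _ =>
    (S.measurable_wealth_apply hL y₀ (s + t) k).mono (F.le _) le_rfl)
  have hv : Measurable[F s] v :=
    measurable_logPos.comp (S.measurable_wealth_apply hL y₀ s m).inv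
  have hle : ∀ ω, (S.logReturn L y₀ s t m ω).toENNReal ≤ (u + v) ω := by
    intro ω
    change logPos (S.wealth L y₀ (s + t) m ω / S.wealth L y₀ s m ω) ≤ _
    rw [div_eq_mul_inv]
    refine (logPos_mul_le _ _).trans (add_le_add (logPos_mono ?_) le_rfl)
    exact Finset.single_le_sum (f := fun k => S.wealth L y₀ (s + t) k ω) (fun _ _ => zero_le)
      (Finset.mem_univ m)
  filter_upwards [condLExp_mono (mΩ := F s) (ae_of_all P hle),
    condLExp_add_left (mΩ := F s) v hu.aemeasurable,
    condLExp_lt_top (mΩ := F s)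
      (S.lintegral_logPos_sum_wealth_lt_top hL y₀ hX hρ (s + t)).ne] with ω h1 h2 h3
  refine h1.trans_lt ?_
  rw [h2, Pi.add_apply, condLExp_eq_self (F.le s) P hv]
  exact ENNReal.add_lt_top.2 ⟨h3, logPos_lt_top _⟩

/-! ### Consequences of relative growth optimality -/

theorem limsup_log_wealth_le [IsFiniteMeasure P] {S : Market P F N} {L : Fin M → Rule Ω M N}
    {y₀ : Fin M → ℝ≥0} {i : Fin M} (hpos : ∀ t, ∀ᵐ ω ∂P, 0 < S.relWealth L y₀ t i ω)
    (hsub : Submartingale (fun t ω => Real.log (S.relWealth L y₀ t i ω)) F P) (m : Fin M) :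
    ∀ᵐ ω ∂P,
      limsup (fun t : ℕ => ENNReal.log (S.wealth L y₀ t m ω : ℝ≥0∞) / (t : EReal)) atTop
        ≤ limsup (fun t : ℕ => ENNReal.log (S.wealth L y₀ t i ω : ℝ≥0∞) / (t : EReal)) atTop := by
  filter_upwards [ae_all_iff.2 hpos, hsub.exists_ae_tendsto_of_nonpos fun t ω =>
    Real.log_nonpos (NNReal.coe_nonneg _) (by exact_mod_cast S.relWealth_le_one L y₀ t i ω)]
    with ω h1 ⟨c, hc⟩
  -- A convergent sequence is bounded below, so `r^i ≥ exp B` for all times and `b = exp (-B)` is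
  -- the domination constant.
  obtain ⟨B, hB⟩ := hc.bddBelow_range
  let b : ℝ≥0 := ⟨Real.exp (-B), (Real.exp_pos _).le⟩
  have hb : b ≠ 0 := fun h => (Real.exp_pos (-B)).ne' (congrArg NNReal.toReal h)
  refine limsup_log_div_le hb fun t => ?_
  have hr : b⁻¹ ≤ S.relWealth L y₀ t i ω := by
    have h2 : B ≤ Real.log (S.relWealth L y₀ t i ω) := hB ⟨t, rfl⟩
    have h3 : Real.exp B ≤ S.relWealth L y₀ t i ω :=
      (Real.le_log_iff_exp_le (NNReal.coe_pos.2 (h1 t))).1 h2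
    rw [← NNReal.coe_le_coe, NNReal.coe_inv]
    change (Real.exp (-B))⁻¹ ≤ _
    rwa [Real.exp_neg, inv_inv]
  have hC : ∑ k, S.wealth L y₀ t k ω ≠ 0 := by
    intro h0
    have := h1 t
    simp [relWealth, h0] at this
  calc S.wealth L y₀ t m ω ≤ ∑ k, S.wealth L y₀ t k ω :=
        Finset.single_le_sum (f := fun k => S.wealth L y₀ t k ω) (fun _ _ => zero_le)
          (Finset.mem_univ m)
    _ = b * (b⁻¹ * ∑ k, S.wealth L y₀ t k ω) := by
        rw [← mul_assoc, mul_inv_cancel₀ hb, one_mul]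
    _ ≤ b * (S.relWealth L y₀ t i ω * ∑ k, S.wealth L y₀ t k ω) := by gcongr
    _ = b * S.wealth L y₀ t i ω := by rw [relWealth, div_mul_cancel₀ _ hC]

end Market

/-- Concavity of the logarithm, for the growth of the capitals `p`, `q` of two investors to
`p'`, `q'`. -/
theorem log_div_add_mul_le {p q p' q' : ℝ} (hp : 0 < p) (hq : 0 < q) (hp' : 0 < p')
    (hq' : 0 < q') :
    Real.log (q' / q) + (p + q) / q * (Real.log (p' / (p' + q')) - Real.log (p / (p + q)))
      ≤ Real.log (p' / p) := by
  have hs : 0 < p + q := add_pos hp hq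
  have hs' : 0 < p' + q' := add_pos hp' hq'
  -- The total return is the mean of the individual returns, weighted by the initial shares of
  -- wealth.
  have hconc := strictConcaveOn_log_Ioi.concaveOn.2 (Set.mem_Ioi.2 (div_pos hp' hp))
    (Set.mem_Ioi.2 (div_pos hq' hq)) (div_pos hp hs).le (div_pos hq hs).le (by field_simp)
  simp only [smul_eq_mul] at hconc
  have hmean : p / (p + q) * (p' / p) + q / (p + q) * (q' / q) = (p' + q') / (p + q) := by
    field_simp
  rw [hmean, Real.log_div hs'.ne' hs.ne', Real.log_div hp'.ne' hp.ne',
    Real.log_div hq'.ne' hq.ne', div_mul_eq_mul_div, div_mul_eq_mul_div, ← add_div,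
    div_le_iff₀ hs] at hconc
  rw [Real.log_div hp'.ne' hs'.ne', Real.log_div hp.ne' hs.ne', Real.log_div hp'.ne' hp.ne',
    Real.log_div hq'.ne' hq.ne', div_mul_eq_mul_div, ← le_sub_iff_add_le', div_le_iff₀ hq]
  linarith

namespace Market

variable {Ω : Type*} [mΩ : MeasurableSpace Ω] {P : Measure Ω} {F : Filtration ℕ mΩ} {N : ℕ}

theorem extCondExp_logReturn_le [IsFiniteMeasure P] {S : Market P F N}
    {L : Fin 2 → Rule Ω 2 N} (hL : ∀ m, IsStrategy F (L m)) {y₀ : Fin 2 → ℝ≥0} {i : Fin 2}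
    (hpos : ∀ t, ∀ᵐ ω ∂P, 0 < S.relWealth L y₀ t i ω)
    (hsub : Submartingale (fun t ω => Real.log (S.relWealth L y₀ t i ω)) F P)
    (m : Fin 2) (s t : ℕ) :
    ∀ᵐ ω ∂P, extCondExp P (F s) (S.logReturn L y₀ s t m) ω
      ≤ extCondExp P (F s) (S.logReturn L y₀ s t i) ω := by
  rcases eq_or_ne m i with rfl | hmi
  · exact ae_of_all _ fun _ => le_rfl
  have hsum : ∀ f : Fin 2 → ℝ≥0, ∑ k, f k = f i + f m := by
    intro f
    have : (Finset.univ : Finset (Fin 2)) = {i, m} := by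
      clear hpos hsub
      decide +revert
    rw [this, Finset.sum_pair hmi.symm]
  have hYm : ∀ u k, Measurable (S.wealth L y₀ u k) := fun u k =>
    (S.measurable_wealth_apply hL y₀ u k).mono (F.le _) le_rfl
  have hlogm : ∀ k, Measurable (S.logReturn L y₀ s t k) := fun k =>
    ((hYm (s + t) k).div (hYm s k)).coe_nnreal_ennreal.ennreal_log
  have hYpos : ∀ u, ∀ᵐ ω ∂P, 0 < S.wealth L y₀ u i ω := by
    intro u
    filter_upwards [hpos u] with ω hω
    refine pos_of_ne_zero fun h0 => ?_
    simp [relWealth, h0] at hω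
  -- The factor `(p + q) / q` of `log_div_add_mul_le`. If `Y_s^m = 0` it is zero by convention,
  -- harmlessly: the log-return of investor `m` is then `⊥`.
  let c : Ω → ℝ≥0 := fun ω => (∑ k, S.wealth L y₀ s k ω) / S.wealth L y₀ s m ω
  let w : Ω → ℝ := fun ω => Real.log (S.relWealth L y₀ (s + t) i ω)
    - Real.log (S.relWealth L y₀ s i ω)
  have hc : Measurable[F s] c := (Finset.measurable_sum _ fun k _ =>
    S.measurable_wealth_apply hL y₀ s k).div (S.measurable_wealth_apply hL y₀ s m)
  have hlr : ∀ u, Measurable fun ω => Real.log (S.relWealth L y₀ u i ω) := fun u =>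
    Real.measurable_log.comp (measurable_coe_nnreal_real.comp
      ((S.measurable_relWealth hL y₀ u i).mono (F.le _) le_rfl))
  have hw : Integrable w P := (hsub.integrable (s + t)).sub (hsub.integrable s)
  refine extCondExp_le_of_add_mul_le (F.le s) (c := c) (w := w) (hlogm m) (hlogm i) hc
    ((hlr (s + t)).sub (hlr s)) hw (hsub.condExp_sub_nonneg (Nat.le_add_right s t)) ?_ ?_
  · filter_upwards [hYpos s, hYpos (s + t)] with ω h1 h2
    refine ⟨fun h => ?_, fun h => ?_⟩
    · exact ENNReal.coe_ne_top (ENNReal.log_eq_top_iff.1 h)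
    · exact (div_pos h2 h1).ne' (ENNReal.coe_eq_zero.1 (ENNReal.log_eq_bot_iff.1 h))
  · filter_upwards [hYpos s, hYpos (s + t)] with ω h1 h2
    by_cases h0 : S.wealth L y₀ (s + t) m ω / S.wealth L y₀ s m ω = 0
    · simp [logReturn, h0]
    · have hq : 0 < S.wealth L y₀ s m ω :=
        pos_of_ne_zero fun h => h0 (by rw [h, div_zero])
      have hq' : 0 < S.wealth L y₀ (s + t) m ω :=
        pos_of_ne_zero fun h => h0 (by rw [h, zero_div])
      rw [logReturn, logReturn, ENNReal.log_of_nnreal h0,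
        ENNReal.log_of_nnreal (div_pos h2 h1).ne', ← EReal.coe_add, EReal.coe_le_coe_iff]
      simp only [c, w, relWealth, hsum]
      push_cast
      exact log_div_add_mul_le (NNReal.coe_pos.2 h1) (NNReal.coe_pos.2 hq) (NNReal.coe_pos.2 h2)
        (NNReal.coe_pos.2 hq')

end Market

/-- Investor `i` (called investor 1 in the model) uses the strategy `Λ̂`, or any other relative
growth optimal strategy; the other investors use arbitrary strategies. -/
theorem theorem3 {Ω : Type*} [mΩ : MeasurableSpace Ω] (P : Measure Ω) [IsProbabilityMeasure P]
    (F : Filtration ℕ mΩ) {M N : ℕ} (hM : 2 ≤ M) (hN : 1 ≤ N) (S : Market P F N)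
    (K : ℕ → Ω → ProbabilityMeasure (Fin N → ℝ≥0)) (hK : S.IsRegularConditionalLaw K)
    (i : Fin M) (L : Fin M → Rule Ω M N)
    (hi : L i = S.hatRule K ∨ S.IsRelativeGrowthOptimal i (L i))
    (hL : ∀ m, m ≠ i → IsStrategy F (L m))
    (y₀ : Fin M → ℝ≥0) (hy₀ : ∀ m, 0 < y₀ m) :
    -- asymptotic growth rate
    (∀ m, ∀ᵐ ω ∂P,
      limsup (fun t : ℕ => ENNReal.log (S.wealth L y₀ t m ω : ℝ≥0∞) / (t : EReal)) atTop
        ≤ limsup (fun t : ℕ => ENNReal.log (S.wealth L y₀ t i ω : ℝ≥0∞) / (t : EReal)) atTop) ∧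
    -- conditional growth rate over `t` steps, for two investors and integrable payoffs
    (M = 2 → (∀ t, Integrable (fun ω => ((∑ n, S.X (t + 1) ω n : ℝ≥0) : ℝ)) P) →
      (∀ m, ∀ s t : ℕ, ∀ᵐ ω ∂P,
        extCondExp P (F s) (S.logReturn L y₀ s t m) ω
          ≤ extCondExp P (F s) (S.logReturn L y₀ s t i) ω) ∧
      -- both sides are well defined, with values in `[-∞, ∞)`, as soon as `E ln⁺ ρ_t < ∞`
      ((∀ t, ∫⁻ ω, (ENNReal.log (S.ρ (t + 1) ω : ℝ≥0∞)).toENNReal ∂P < ∞) →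
        ∀ m, ∀ s t : ℕ, ∀ᵐ ω ∂P,
          condLExp (F s) P (fun ω' => (S.logReturn L y₀ s t m ω').toENNReal) ω < ∞)) := by
  have hstrat : ∀ m, IsStrategy F (L m) := by
    intro m
    rcases eq_or_ne m i with rfl | hm
    · rcases hi with hi | hi
      · rw [hi]
        exact Market.isStrategy_hatRule hK
      · exact hi.1
    · exact hL m hm
  obtain ⟨hpos, hsub⟩ : (∀ t, ∀ᵐ ω ∂P, 0 < S.relWealth L y₀ t i ω) ∧
      Submartingale (fun t ω => Real.log (S.relWealth L y₀ t i ω)) F P := by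
    rcases hi with hi | hi
    · exact Market.submartingale_log_relWealth_hatRule hK hstrat hi hy₀
    · exact hi.2 y₀ L hy₀ rfl hL
  refine ⟨fun m => Market.limsup_log_wealth_le hpos hsub m, ?_⟩
  rintro rfl hX
  exact ⟨fun m s t => Market.extCondExp_logReturn_le hstrat hpos hsub m s t,
    fun hρ m s t => S.ae_condLExp_logReturn_lt_top hstrat y₀ hX hρ m s t⟩
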